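/- Let $(u,v)=\sum_i u^iv^i$ be the standard bilinear form on $\mathbb C^N$ with standard basis $e_1,\dots,e_N$. For a finite set $\mathcal A\subset\mathbb C^N$ of non-zero vectors with multiplicities $c_\alpha\in\mathbb C$ put $$F(x)=\sum_{\alpha\in\mathcal A}c_\alpha f((\alpha,x)),\qquad F_{ij}=\frac{\partial^2F}{\partial x^i\partial x^j},$$ where $f(z)=\tfrac16 iz^3+\tfrac14\mathrm{Li}_3(e^{-2iz})$, continued analytically, so that $f'''(z)=\cot z$; any local holomorphic branch with $f'''=\cot$ may be used. For $c_0,H_0,\bar c_\alpha\in\mathbb C$ consider $$H(x)=H_0+\sum_{\alpha\in\mathcal A}\bar c_\alpha\sin^2(\alpha,x),\qquad e=c_0H^{-1}\sum_{\alpha\in\mathcal A}\bar c_\alpha\sin(2(\alpha,x))\,\partial_\alpha,\qquad \partial_\alpha=\sum_i\alpha^i\partial_{x^i}.$$ **Theorem.** In each of the following cases $H$ is not identically zero, and $e(F_{ij})=\delta_{ij}$ for all $i,j$ at every point $x$ with $H(x)\neq0$ and $\sin(\alpha,x)\ne0$ for all $\alpha\in\mathcal A$. 1. $\mathcal A=F_4^+$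 or one of the projections $(F_4,A_1)_1$, $(F_4,A_1)_2$, $(F_4,A_2)_1$, $(F_4,A_2)_2$, $(F_4,B_2)$, $(F_4,A_1^2)$ listed below, with $r=-2q\ne0$, $c_0=-\frac1{4q}$, $H_0=0$, $\bar c_\alpha=c_\alpha$. 2. $\mathcal A$ as in 1, with $r=-4q\neq0$, $c_0=\frac1{4q}$, $H_0=36q$, and $\bar c_\alpha=c_\alpha|_{q=0}$, that is, $q$ is replaced by $0$ in the formula for $c_\alpha$ below while $r$ is kept. 3. $\mathcal A=G_2^+$ with $p=-3q\ne0$, $c_0=-\frac1{9q}$, $H_0=0$, $\bar c_\alpha=c_\alpha$. 4. $\mathcal A=G_2^+$ with $p=-9q\ne0$, $c_0=\frac1{9q}$, $H_0=27q$, $\bar c_\alpha=c_\alpha|_{q=0}$ ($p$ kept). 5. $\mathcal A=BC_n(q,r,s;\underline m)$ with $n\ge2$, $\underline m=(m_1,\dots,m_n)\in(\mathbb C^\times)^n$, $q\neq0$, $r\ne0$, $r=-8s-2q\big(\sum_{i=1}^nm_i-2\big)$, $c_0=-\frac1{4q}$, $H_0=\frac{r(2s-q)}q$, $\bar c_\alpha=c_\alpha|_{q=s=0}$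 ($r$ and $\underline m$ kept). 6. $\mathcal A=BC_1^+=\{e_1,2e_1\}\subset\mathbb C^1$ with $c_{e_1}=r$, $c_{2e_1}=s$, $r\neq0$, $r+8s\ne0$, $c_0=-\frac1{2(r+8s)}$, $H_0=-\frac{r(r+4s)}{r+8s}$, $\bar c_{e_1}=r$, $\bar c_{2e_1}=0$. The configurations are as follows (vectors : multiplicity; all combinations of signs occur). - $F_4^+\subset\mathbb C^4$: $e_i$ : $r$; $\frac12(e_1\pm e_2\pm e_3\pm e_4)$ : $r$; $e_i\pm e_j$ $(i<j)$ : $q$. Its projections below are orthogonal projections to intersections of mirrors, written in orthonormal coordinates. - $(F_4,A_1)_1\subset\mathbb C^3$: $e_i$ : $r+2q$; $e_i\pm e_j$ $(i<j)$ : $q$; $\frac12(e_1\pm e_2\pm e_3)$ : $2r$. - $(F_4,A_1)_2\subset\mathbb C^3$: $e_1,e_2$ : $r$; $\sqrt2e_3$ : $q$; $\frac{\sqrt2}2e_3$ : $2r$; $e_1\pm e_2$ : $q$; $\frac12(e_1\pm e_2)$ : $2r$; $e_1\pm\frac{\sqrt2}2e_3$, $e_2\pm\frac{\sqrt2}2e_3$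 : $2q$; $\frac12(e_1\pm e_2\pm\sqrt2e_3)$ : $r$. - $(F_4,A_2)_1\subset\mathbb C^2$: $e_1$ : $r$; $\frac1{\sqrt3}e_2$ : $3r$; $\frac2{\sqrt3}e_2$ : $3q$; $e_1\pm\frac1{\sqrt3}e_2$ : $3q$; $\frac12(e_1\pm\frac1{\sqrt3}e_2)$ : $3r$; $\frac12(e_1\pm\frac3{\sqrt3}e_2)$ : $r$. - $(F_4,A_2)_2\subset\mathbb C^2$: $\sqrt2e_1$, $\frac1{\sqrt2}e_1\pm\frac3{\sqrt6}e_2$ : $q$; $\frac2{\sqrt6}e_2$, $\frac1{\sqrt2}e_1\pm\frac1{\sqrt6}e_2$ : $3r+3q$. - $(F_4,B_2)\subset\mathbb C^2$: $e_1,e_2$ : $r+4q$; $e_1\pm e_2$ : $q$; $\frac12(e_1\pm e_2)$ : $4r$. - $(F_4,A_1^2)\subset\mathbb C^2$: $e_1$ : $r+2q$; $\sqrt2e_2$ : $q$; $\frac12e_1$ : $4r$; $\frac{\sqrt2}2e_2$ : $2(r+2q)$; $e_1\pm\frac1{\sqrt2}e_2$ : $2q$; $\frac12(e_1\pm\frac2{\sqrt2}e_2)$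 : $2r$. - $G_2^+\subset\mathbb C^2$: $\sqrt3e_1$, $\frac12(\sqrt3e_1\pm3e_2)$ : $q$; $e_2$, $\frac12(\sqrt3e_1\pm e_2)$ : $p$. - $BC_n(q,r,s;\underline m)\subset\mathbb C^n$, for any choice of the square roots $m_i^{-1/2}$: $m_i^{-1/2}e_i$ : $rm_i$; $2m_i^{-1/2}e_i$ : $sm_i+\frac12qm_i(m_i-1)$; $m_i^{-1/2}e_i\pm m_j^{-1/2}e_j$ $(i<j)$ : $qm_im_j$. -/

import Mathlib

open scoped BigOperators Topology Matrix

noncomputable section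

/-- The polylogarithm series `Li_s(w) = ∑_{n ≥ 1} w ^ n / n ^ s` (convergent for `|w| < 1`). -/
def polylogSeries (s : ℕ) (w : ℂ) : ℂ := ∑' n : ℕ, w ^ (n + 1) / ((n : ℂ) + 1) ^ s

/-- `f(z) = i z³ / 6 + Li₃(exp(-2 i z)) / 4`, with `Li₃` given by its series.  The series converges
for `Im z < 0`; elsewhere the function is understood through analytic continuation. -/
def trilogFn (z : ℂ) : ℂ :=
  Complex.I * z ^ 3 / 6 + polylogSeries 3 (Complex.exp (-2 * Complex.I * z)) / 4

/-- `f` is, near `z`, a holomorphic function with `f''' = cot`.  Every branch of the analytic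
continuation of `trilogFn` has this property at each `z` with `sin z ≠ 0`. -/
def IsTrilogBranchAt (f : ℂ → ℂ) (z : ℂ) : Prop :=
  AnalyticAt ℂ f z ∧ iteratedDeriv 3 f =ᶠ[𝓝 z] Complex.cot

theorem hasDerivAt_polylogSeries_exp (s : ℕ) {z : ℂ} (hz : z.im < 0) :
    HasDerivAt (fun z => polylogSeries (s + 1) (Complex.exp (-2 * Complex.I * z)))
      (-2 * Complex.I * polylogSeries s (Complex.exp (-2 * Complex.I * z))) z := by
  have hd : ∀ (n : ℕ) (y : ℂ), HasDerivAt
      (fun z : ℂ => Complex.exp (-2 * Complex.I * z) ^ (n + 1) / ((n : ℂ) + 1) ^ (s + 1))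
      (-2 * Complex.I * (Complex.exp (-2 * Complex.I * y) ^ (n + 1) / ((n : ℂ) + 1) ^ s)) y := by
    intro n y
    have h1 : HasDerivAt (fun z : ℂ => -2 * Complex.I * z) (-2 * Complex.I) y := by
      simpa using (hasDerivAt_id y).const_mul (-2 * Complex.I)
    have hn : (n : ℂ) + 1 ≠ 0 := by exact_mod_cast Nat.succ_ne_zero n
    refine (((h1.cexp).pow (n + 1)).div_const (((n : ℂ) + 1) ^ (s + 1))).congr_deriv ?_
    simp only [Nat.add_sub_cancel]
    push_cast
    field_simp
    ring
  set U : Set ℂ := {y | y.im < z.im / 2} with hU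
  have hUo : IsOpen U := isOpen_lt Complex.continuous_im continuous_const
  have hzU : z ∈ U := by show z.im < z.im / 2; linarith
  have hρ : Real.exp z.im < 1 := by rw [← Real.exp_zero]; exact Real.exp_lt_exp.2 hz
  have hsum : Summable fun n : ℕ => Real.exp z.im ^ (n + 1) :=
    (summable_nat_add_iff 1).2 (summable_geometric_of_lt_one (Real.exp_pos _).le hρ)
  have hb : ∀ (n : ℕ) (y : ℂ), y ∈ U →
      ‖Complex.exp (-2 * Complex.I * y) ^ (n + 1) / ((n : ℂ) + 1) ^ (s + 1)‖
        ≤ Real.exp z.im ^ (n + 1) := by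
    intro n y hy
    have hy' : y.im < z.im / 2 := hy
    rw [norm_div, norm_pow, norm_pow, Complex.norm_exp]
    have h1 : (-2 * Complex.I * y).re = 2 * y.im := by simp
    have h2 : ‖(n : ℂ) + 1‖ = (n : ℝ) + 1 := by
      have := Complex.norm_natCast (n + 1)
      push_cast at this
      exact this
    rw [h1, h2]
    have h3 : (1 : ℝ) ≤ ((n : ℝ) + 1) ^ (s + 1) := one_le_pow₀ (by linarith [n.cast_nonneg (α := ℝ)])
    refine (div_le_self (by positivity) h3).trans ?_
    gcongr
    linarith
  have hdiff := Complex.differentiableOn_tsum_of_summable_norm hsum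
    (fun n => fun y _ => (hd n y).differentiableAt.differentiableWithinAt) hUo hb
  have hds := Complex.hasSum_deriv_of_summable_norm hsum
    (fun n => fun y _ => (hd n y).differentiableAt.differentiableWithinAt) hUo hb hzU
  have hda := ((hdiff z hzU).differentiableAt (hUo.mem_nhds hzU)).hasDerivAt
  have hval := hds.tsum_eq
  simp only [fun n => (hd n z).deriv] at hval
  rw [← hval, tsum_mul_left] at hda
  exact hda

/-- In the half-plane `Im z < 0`, where its series converges, `trilogFn` itself is a branch. -/
theorem trilogFn_isTrilogBranchAt {z : ℂ} (hz : z.im < 0) : IsTrilogBranchAt trilogFn z := by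
  have hUo : IsOpen {y : ℂ | y.im < 0} := isOpen_lt Complex.continuous_im continuous_const
  have hd0 : ∀ y ∈ {y : ℂ | y.im < 0}, HasDerivAt trilogFn (Complex.I * y ^ 2 / 2 +
      -Complex.I / 2 * polylogSeries 2 (Complex.exp (-2 * Complex.I * y))) y := by
    intro y hy
    refine ((((hasDerivAt_pow 3 y).const_mul Complex.I).div_const 6).add
      ((hasDerivAt_polylogSeries_exp 2 hy).div_const 4)).congr_deriv ?_
    push_cast
    ring
  have hd1 : ∀ y ∈ {y : ℂ | y.im < 0}, HasDerivAt (fun y => Complex.I * y ^ 2 / 2 +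
      -Complex.I / 2 * polylogSeries 2 (Complex.exp (-2 * Complex.I * y)))
      (Complex.I * y - polylogSeries 1 (Complex.exp (-2 * Complex.I * y))) y := by
    intro y hy
    refine ((((hasDerivAt_pow 2 y).const_mul Complex.I).div_const 2).add
      ((hasDerivAt_polylogSeries_exp 1 hy).const_mul (-Complex.I / 2))).congr_deriv ?_
    push_cast
    ring_nf
    rw [Complex.I_sq]
    ring
  have hd2 : ∀ y ∈ {y : ℂ | y.im < 0}, HasDerivAt
      (fun y => Complex.I * y - polylogSeries 1 (Complex.exp (-2 * Complex.I * y)))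
      (Complex.cot y) y := by
    intro y hy
    have hy' : y.im < 0 := hy
    refine (((hasDerivAt_id y).const_mul Complex.I).sub
      (hasDerivAt_polylogSeries_exp 0 hy)).congr_deriv ?_
    have hw : ‖Complex.exp (-2 * Complex.I * y)‖ < 1 := by
      rw [Complex.norm_exp]
      have h1 : (-2 * Complex.I * y).re = 2 * y.im := by simp
      rw [h1]
      rw [← Real.exp_zero]
      exact Real.exp_lt_exp.2 (by linarith)
    have hs : polylogSeries 0 (Complex.exp (-2 * Complex.I * y)) =
        Complex.exp (-2 * Complex.I * y) * (1 - Complex.exp (-2 * Complex.I * y))⁻¹ := by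
      simp only [polylogSeries, pow_zero, div_one, pow_succ']
      rw [tsum_mul_left, tsum_geometric_of_norm_lt_one hw]
    rw [hs, Complex.cot_eq_exp_ratio]
    have he : Complex.exp (2 * Complex.I * y) * Complex.exp (-2 * Complex.I * y) = 1 := by
      rw [← Complex.exp_add]; ring_nf; simp
    have hw1 : Complex.exp (-2 * Complex.I * y) ≠ 1 := by
      intro h; rw [h] at hw; simp at hw
    generalize Complex.exp (-2 * Complex.I * y) = w at *
    have hw0 : w ≠ 0 := by rintro rfl; simp at he
    have hE : Complex.exp (2 * Complex.I * y) = w⁻¹ := eq_inv_of_mul_eq_one_left he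
    rw [hE]
    have h1 : 1 - w ≠ 0 := sub_ne_zero.2 (Ne.symm hw1)
    have h2 : w - 1 ≠ 0 := sub_ne_zero.2 hw1
    have h3 : 1 - w⁻¹ = (w - 1) / w := by field_simp
    have h4 : w - 1 = -(1 - w) := by ring
    rw [h3, h4]
    field_simp
    rw [Complex.I_sq]
    ring
  have hnhds := hUo.mem_nhds (show z ∈ {y : ℂ | y.im < 0} from hz)
  refine ⟨DifferentiableOn.analyticAt
    (fun y hy => (hd0 y hy).differentiableAt.differentiableWithinAt) hnhds, ?_⟩
  have e1 : ∀ y ∈ {y : ℂ | y.im < 0}, deriv trilogFn y = Complex.I * y ^ 2 / 2 +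
      -Complex.I / 2 * polylogSeries 2 (Complex.exp (-2 * Complex.I * y)) :=
    fun y hy => (hd0 y hy).deriv
  have e2 : ∀ y ∈ {y : ℂ | y.im < 0}, deriv (deriv trilogFn) y =
      Complex.I * y - polylogSeries 1 (Complex.exp (-2 * Complex.I * y)) := by
    intro y hy
    rw [(Filter.eventuallyEq_of_mem (hUo.mem_nhds hy) e1).deriv_eq]
    exact (hd1 y hy).deriv
  refine Filter.eventuallyEq_of_mem hnhds fun y hy => ?_
  simp only [iteratedDeriv_succ, iteratedDeriv_zero]
  rw [(Filter.eventuallyEq_of_mem (hUo.mem_nhds hy) e2).deriv_eq]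
  exact (hd2 y hy).deriv

/-- A finite configuration of vectors in `ℂ^N`, indexed by `ι`, with complex multiplicities. -/
structure TrigConfig (N : ℕ) (ι : Type) where
  vec : ι → Fin N → ℂ
  mult : ι → ℂ

namespace TrigConfig

variable {N : ℕ} {ι : Type} [Fintype ι]

/-- `F(x) = ∑_α c_α f((α, x))`, where `(·, ·)` is the standard bilinear form. -/
def potential (A : TrigConfig N ι) (f : ℂ → ℂ) (x : Fin N → ℂ) : ℂ :=
  ∑ k, A.mult k * f (A.vec k ⬝ᵥ x)

/-- `H(x) = H₀ + ∑_α c̄_α sin²(α, x)`. -/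
def denom (A : TrigConfig N ι) (cbar : ι → ℂ) (H₀ : ℂ) (x : Fin N → ℂ) : ℂ :=
  H₀ + ∑ k, cbar k * Complex.sin (A.vec k ⬝ᵥ x) ^ 2

/-- The vector field `e = c₀ H⁻¹ ∑_α c̄_α sin(2 (α, x)) ∂_α`. -/
def field (A : TrigConfig N ι) (cbar : ι → ℂ) (c₀ H₀ : ℂ) (x : Fin N → ℂ) : Fin N → ℂ :=
  (c₀ * (A.denom cbar H₀ x)⁻¹) •
    ∑ k, (cbar k * Complex.sin (2 * (A.vec k ⬝ᵥ x))) • A.vec k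

end TrigConfig

/-- The partial derivative `∂G / ∂x^i`. -/
def partialDeriv {N : ℕ} (i : Fin N) (G : (Fin N → ℂ) → ℂ) (x : Fin N → ℂ) : ℂ :=
  fderiv ℂ G x (Pi.single i 1)

/-- `e(F_ij) = δ_ij` for the vector field `e` with parameters `c̄`, `c₀`, `H₀`: the function `H` is
not identically zero, and at every point `x` off the mirrors `sin (α, x) = 0` with `H(x) ≠ 0` the
derivative of `F_ij = ∂²F / ∂x^i ∂x^j` along `e` is `δ_ij`, whichever branch of `f` is used. -/
def TrigConfig.FieldIsIdentity {N : ℕ} {ι : Type} [Fintype ι] (A : TrigConfig N ι)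
    (cbar : ι → ℂ) (c₀ H₀ : ℂ) : Prop :=
  (∃ x, A.denom cbar H₀ x ≠ 0) ∧
  ∀ (f : ℂ → ℂ) (x : Fin N → ℂ),
    (∀ k, Complex.sin (A.vec k ⬝ᵥ x) ≠ 0 ∧ IsTrilogBranchAt f (A.vec k ⬝ᵥ x)) →
    A.denom cbar H₀ x ≠ 0 →
    ∀ i j : Fin N,
      fderiv ℂ (partialDeriv i (partialDeriv j (A.potential f))) x (A.field cbar c₀ H₀ x)
        = if i = j then 1 else 0

/-- `√2` as a complex number. -/
def sqrtTwo : ℂ := ((Real.sqrt 2 : ℝ) : ℂ)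

/-- `√3` as a complex number. -/
def sqrtThree : ℂ := ((Real.sqrt 3 : ℝ) : ℂ)

/-- `√6` as a complex number. -/
def sqrtSix : ℂ := ((Real.sqrt 6 : ℝ) : ℂ)

/-- The positive half of the root system `F₄`: multiplicity `r` for the short roots and `q` for the
long roots. -/
def configF4 (q r : ℂ) : TrigConfig 4 (Fin 24) where
  vec := ![![1, 0, 0, 0], ![0, 1, 0, 0], ![0, 0, 1, 0], ![0, 0, 0, 1],
    ![1, 1, 0, 0], ![1, -1, 0, 0], ![1, 0, 1, 0], ![1, 0, -1, 0],
    ![1, 0, 0, 1], ![1, 0, 0, -1], ![0, 1, 1, 0], ![0, 1, -1, 0],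
    ![0, 1, 0, 1], ![0, 1, 0, -1], ![0, 0, 1, 1], ![0, 0, 1, -1],
    ![1/2, 1/2, 1/2, 1/2], ![1/2, 1/2, 1/2, -1/2],
    ![1/2, 1/2, -1/2, 1/2], ![1/2, 1/2, -1/2, -1/2],
    ![1/2, -1/2, 1/2, 1/2], ![1/2, -1/2, 1/2, -1/2],
    ![1/2, -1/2, -1/2, 1/2], ![1/2, -1/2, -1/2, -1/2]]
  mult := ![r, r, r, r, q, q, q, q, q, q, q, q, q, q, q, q, r, r, r, r, r, r, r, r]

/-- The projection `(F₄, A₁)₁` of `F₄⁺` to the hyperplane `α₃ = 0`. Here and below the simple roots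
are `α₁ = e₂ - e₃`, `α₂ = e₃ - e₄`, `α₃ = e₄`, `α₄ = (e₁ - e₂ - e₃ - e₄) / 2`. -/
def configF4A1one (q r : ℂ) : TrigConfig 3 (Fin 13) where
  vec := ![![1, 0, 0], ![0, 1, 0], ![0, 0, 1],
    ![1, 1, 0], ![1, -1, 0], ![1, 0, 1], ![1, 0, -1], ![0, 1, 1], ![0, 1, -1],
    ![1/2, 1/2, 1/2], ![1/2, 1/2, -1/2], ![1/2, -1/2, 1/2], ![1/2, -1/2, -1/2]]
  mult := ![r + 2 * q, r + 2 * q, r + 2 * q, q, q, q, q, q, q, 2 * r, 2 * r, 2 * r, 2 * r]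

/-- The projection `(F₄, A₁)₂` of `F₄⁺` to the hyperplane `α₂ = 0`. -/
def configF4A1two (q r : ℂ) : TrigConfig 3 (Fin 16) where
  vec := ![![1, 0, 0], ![0, 1, 0],
    ![0, 0, sqrtTwo], ![0, 0, sqrtTwo / 2],
    ![1, 1, 0], ![1, -1, 0], ![1/2, 1/2, 0], ![1/2, -1/2, 0],
    ![1, 0, sqrtTwo / 2], ![1, 0, -sqrtTwo / 2], ![0, 1, sqrtTwo / 2], ![0, 1, -sqrtTwo / 2],
    ![1/2, 1/2, sqrtTwo / 2], ![1/2, 1/2, -sqrtTwo / 2],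
    ![1/2, -1/2, sqrtTwo / 2], ![1/2, -1/2, -sqrtTwo / 2]]
  mult := ![r, r, q, 2 * r, q, q, 2 * r, 2 * r, 2 * q, 2 * q, 2 * q, 2 * q, r, r, r, r]

/-- The projection `(F₄, A₂)₁` of `F₄⁺` to the plane `α₁ = α₂ = 0`. -/
def configF4A2one (q r : ℂ) : TrigConfig 2 (Fin 9) where
  vec := ![![1, 0], ![0, 1 / sqrtThree], ![0, 2 / sqrtThree],
    ![1, 1 / sqrtThree], ![1, -1 / sqrtThree],
    ![1/2, 1/2 * (1 / sqrtThree)], ![1/2, -1/2 * (1 / sqrtThree)],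
    ![1/2, 1/2 * (3 / sqrtThree)], ![1/2, -1/2 * (3 / sqrtThree)]]
  mult := ![r, 3 * r, 3 * q, 3 * q, 3 * q, 3 * r, 3 * r, r, r]

/-- The projection `(F₄, A₂)₂` of `F₄⁺` to the plane `α₃ = α₄ = 0`, written in the orthonormal basis
`(e₂ - e₃) / √2`, `(2 e₁ + e₂ + e₃) / √6` of this plane; up to scaling by `√(2/3)` it is a root
system `G₂`. -/
def configF4A2two (q r : ℂ) : TrigConfig 2 (Fin 6) where
  vec := ![![sqrtTwo, 0], ![1 / sqrtTwo, 3 / sqrtSix], ![1 / sqrtTwo, -3 / sqrtSix],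
    ![0, 2 / sqrtSix], ![1 / sqrtTwo, 1 / sqrtSix], ![1 / sqrtTwo, -1 / sqrtSix]]
  mult := ![q, q, q, 3 * r + 3 * q, 3 * r + 3 * q, 3 * r + 3 * q]

/-- The projection `(F₄, B₂)` of `F₄⁺` to the plane `α₂ = α₃ = 0`, written in the orthonormal basis
`e₁`, `e₂`; it is a root system `BC₂`. -/
def configF4B2 (q r : ℂ) : TrigConfig 2 (Fin 6) where
  vec := ![![1, 0], ![0, 1], ![1, 1], ![1, -1], ![1/2, 1/2], ![1/2, -1/2]]
  mult := ![r + 4 * q, r + 4 * q, q, q, 4 * r, 4 * r]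

/-- The projection `(F₄, A₁²)` of `F₄⁺` to the plane `α₁ = α₃ = 0`. -/
def configF4A1sq (q r : ℂ) : TrigConfig 2 (Fin 8) where
  vec := ![![1, 0], ![0, sqrtTwo], ![1/2, 0], ![0, sqrtTwo / 2],
    ![1, 1 / sqrtTwo], ![1, -1 / sqrtTwo],
    ![1/2, 1/2 * (2 / sqrtTwo)], ![1/2, -1/2 * (2 / sqrtTwo)]]
  mult := ![r + 2 * q, q, 4 * r, 2 * (r + 2 * q), 2 * q, 2 * q, 2 * r, 2 * r]

/-- The positive half of the root system `G₂`: multiplicity `q` for the long roots and `p` for the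
short roots. -/
def configG2 (q p : ℂ) : TrigConfig 2 (Fin 6) where
  vec := ![![sqrtThree, 0], ![sqrtThree / 2, 3 / 2], ![sqrtThree / 2, -3 / 2],
    ![0, 1], ![sqrtThree / 2, 1 / 2], ![sqrtThree / 2, -1 / 2]]
  mult := ![q, q, q, p, p, p]

/-- Indices for `BC_n(q, r, s; m)`: the vectors along `e_i`, those along `2 e_i`, and the vectors
with two non-zero coordinates `i < j`, with sign `+` for `true` and `-` for `false`. -/
abbrev BCIndex (n : ℕ) : Type :=
  Fin n ⊕ Fin n ⊕ ({p : Fin n × Fin n // p.1 < p.2} × Bool)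

/-- The configuration `BC_n(q, r, s; m)`, where `w i` stands for the chosen value of
`m_i ^ (-1/2)`. -/
def configBC (n : ℕ) (q r s : ℂ) (m w : Fin n → ℂ) : TrigConfig n (BCIndex n) where
  vec
    | .inl i => Pi.single i (w i)
    | .inr (.inl i) => Pi.single i (2 * w i)
    | .inr (.inr (p, true)) => Pi.single p.1.1 (w p.1.1) + Pi.single p.1.2 (w p.1.2)
    | .inr (.inr (p, false)) => Pi.single p.1.1 (w p.1.1) - Pi.single p.1.2 (w p.1.2)
  mult
    | .inl i => r * m i
    | .inr (.inl i) => s * m i + 1 / 2 * q * m i * (m i - 1)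
    | .inr (.inr (p, _)) => q * m p.1.1 * m p.1.2

/-- The positive half `{e₁, 2 e₁}` of the root system `BC₁`, with multiplicities `r` and `s`. -/
def configBC1 (r s : ℂ) : TrigConfig 1 (Fin 2) where
  vec := ![![1], ![2]]
  mult := ![r, s]

/-- The projections of the vectors of `F₄⁺` in the basis used for `(F₄, A₂)₂`, up to sign and with
multiplicities, are the listed vectors and `0` (with multiplicity `3 r`). -/
theorem configF4A2two_isProjection (q r : ℂ) (g : (Fin 2 → ℂ) → ℂ) (hg : ∀ v, g (-v) = g v) :
    ∑ k, (configF4 q r).mult k *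
        g ![(configF4 q r).vec k ⬝ᵥ ![0, 1 / sqrtTwo, -1 / sqrtTwo, 0],
          (configF4 q r).vec k ⬝ᵥ ![2 / sqrtSix, 1 / sqrtSix, 1 / sqrtSix, 0]]
      = ∑ k, (configF4A2two q r).mult k * g ((configF4A2two q r).vec k) + 3 * r * g 0 := by
  have h2 : sqrtTwo⁻¹ * 2 = sqrtTwo := by
    have h : sqrtTwo * sqrtTwo = 2 := by
      rw [sqrtTwo, ← Complex.ofReal_mul, Real.mul_self_sqrt (by norm_num)]; norm_num
    have h0 : sqrtTwo ≠ 0 := by rintro h0; rw [h0] at h; norm_num at h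
    field_simp
    rw [pow_two, h]
  have hz : (0 : Fin 2 → ℂ) = ![0, 0] := by ext i; fin_cases i <;> rfl
  have hn : ∀ a b : ℂ, g ![-a, b] = g ![a, -b] := fun a b => by
    rw [← hg]; congr 1; ext i; fin_cases i <;> simp
  rw [hz]
  simp only [configF4, configF4A2two, Fin.sum_univ_succ, Fin.sum_univ_zero, dotProduct,
    Matrix.cons_val_zero, Matrix.cons_val_succ, add_zero, zero_mul, one_mul, mul_zero,
    zero_add, neg_mul, div_eq_mul_inv]
  ring_nf
  simp only [h2, hn]
  ring

/-- The same for `(F₄, B₂)`, where no signs are needed and `0` has multiplicity `2 r + 2 q`. -/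
theorem configF4B2_isProjection (q r : ℂ) (g : (Fin 2 → ℂ) → ℂ) :
    ∑ k, (configF4 q r).mult k * g ![(configF4 q r).vec k 0, (configF4 q r).vec k 1]
      = ∑ k, (configF4B2 q r).mult k * g ((configF4B2 q r).vec k) + (2 * r + 2 * q) * g 0 := by
  have hz : (0 : Fin 2 → ℂ) = ![0, 0] := by ext i; fin_cases i <;> rfl
  rw [hz]
  simp [configF4, configF4B2, Fin.sum_univ_succ]
  ring

end

/-! ### Third derivatives of `F` and reduction to a cotangent identity. -/

noncomputable section

namespace TrigConfig

variable {N : ℕ} {ι : Type} [Fintype ι]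

/-! Let `V = ∑ c̄_β sin(2(β,x)) β`, which is the gradient of `H`, so that `e = c₀ H⁻¹ V`. Since
`f''' = cot`, the claim becomes `c₀ ∑ c_α α_i α_j cot(α,x) (α,V) = H δ_ij`.

For `F₄` and `G₂` the function `H` is Weyl invariant, so `(α,V)` vanishes on the mirror of `α`, and
`cot(α,x) (α,V)` is a trigonometric polynomial `T_α` (`sin_mul_cotPoly`). The claim is then an
identity of trigonometric polynomials, and comparing coefficients gives the relation between the
multiplicities (`sum_cotPoly_of_eq_neg_two_mul`, `sum_cotPoly_of_eq_neg_four_mul`).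

Having `T_α` defined on the mirrors themselves is what makes projection work
(`IsCotContinuation.fieldIsIdentity_of_projectsTo`). On an intersection of mirrors `V` is tangent to
it, roots orthogonal to it get weight zero in the tangential entries, and all other roots enter only
through their projections. Each projected case is thus a restriction of the `F₄` identity.

For `BC_n` and `BC₁` the coefficients `c̄` live on the vectors along `e_i` only, so the components
of `V` decouple and the sum follows from sum-to-product formulas (`BC.sum_cot`). The relation on `r`
removes the only term that depends on the diagonal position. -/

theorem hasFDerivAt_sum_comp_dotProduct (vec : ι → Fin N → ℂ) (a : ι → ℂ) (h : ℂ → ℂ)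
    {x : Fin N → ℂ} (hh : ∀ k, DifferentiableAt ℂ h (vec k ⬝ᵥ x)) :
    HasFDerivAt (fun y => ∑ k, a k * h (vec k ⬝ᵥ y))
      (∑ k, (a k * deriv h (vec k ⬝ᵥ x)) •
        LinearMap.toContinuousLinearMap (dotProductBilin ℂ ℂ (vec k))) x := by
  refine HasFDerivAt.fun_sum fun k _ => ?_
  have h1 : HasFDerivAt (fun y : Fin N → ℂ => vec k ⬝ᵥ y)
      (LinearMap.toContinuousLinearMap (dotProductBilin ℂ ℂ (vec k))) x :=
    (LinearMap.toContinuousLinearMap (dotProductBilin ℂ ℂ (vec k))).hasFDerivAt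
  have h2 := ((hh k).hasDerivAt.comp_hasFDerivAt x h1).const_mul (a k)
  rwa [smul_smul] at h2

theorem fderiv_sum_comp_dotProduct (vec : ι → Fin N → ℂ) (a : ι → ℂ) (h : ℂ → ℂ)
    {x : Fin N → ℂ} (hh : ∀ k, DifferentiableAt ℂ h (vec k ⬝ᵥ x)) (v : Fin N → ℂ) :
    fderiv ℂ (fun y => ∑ k, a k * h (vec k ⬝ᵥ y)) x v =
      ∑ k, a k * deriv h (vec k ⬝ᵥ x) * (vec k ⬝ᵥ v) := by
  rw [(hasFDerivAt_sum_comp_dotProduct vec a h hh).fderiv]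
  simp

/-- Sums of ridge functions are closed under differentiation, so this can be applied repeatedly.
Equality on a neighbourhood, not just at `x`, is what the next derivative needs. -/
theorem partialDeriv_sum_comp_dotProduct (vec : ι → Fin N → ℂ) (a : ι → ℂ) (h : ℂ → ℂ)
    {x : Fin N → ℂ} (hh : ∀ k, AnalyticAt ℂ h (vec k ⬝ᵥ x)) (j : Fin N) :
    partialDeriv j (fun y => ∑ k, a k * h (vec k ⬝ᵥ y)) =ᶠ[𝓝 x]
      fun y => ∑ k, (a k * vec k j) * deriv h (vec k ⬝ᵥ y) := by
  have hcont : ∀ k, ContinuousAt (fun y : Fin N → ℂ => vec k ⬝ᵥ y) x := fun k =>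
    (LinearMap.toContinuousLinearMap (dotProductBilin ℂ ℂ (vec k))).continuous.continuousAt
  have hev : ∀ᶠ y in 𝓝 x, ∀ k, AnalyticAt ℂ h (vec k ⬝ᵥ y) :=
    Filter.eventually_all.2 fun k => (hcont k).eventually (hh k).eventually_analyticAt
  filter_upwards [hev] with y hy
  rw [partialDeriv, fderiv_sum_comp_dotProduct vec a h fun k => (hy k).differentiableAt]
  refine Finset.sum_congr rfl fun k _ => ?_
  rw [dotProduct_single_one]
  ring

/-- The third derivatives of the potential along a vector `v`, off the mirrors. -/
theorem fderiv_partialDeriv_partialDeriv_potential (A : TrigConfig N ι) {f : ℂ → ℂ}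
    {x : Fin N → ℂ} (hf : ∀ k, IsTrilogBranchAt f (A.vec k ⬝ᵥ x)) (i j : Fin N)
    (v : Fin N → ℂ) :
    fderiv ℂ (partialDeriv i (partialDeriv j (A.potential f))) x v =
      ∑ k, A.mult k * A.vec k i * A.vec k j * Complex.cot (A.vec k ⬝ᵥ x) * (A.vec k ⬝ᵥ v) := by
  have h1 := partialDeriv_sum_comp_dotProduct A.vec A.mult f (fun k => (hf k).1) j
  have h2 : partialDeriv i (partialDeriv j (A.potential f)) =ᶠ[𝓝 x]
      fun y => ∑ k, (A.mult k * A.vec k j * A.vec k i) * deriv (deriv f) (A.vec k ⬝ᵥ y) := by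
    refine Filter.EventuallyEq.trans ?_ (partialDeriv_sum_comp_dotProduct A.vec
      (fun k => A.mult k * A.vec k j) (deriv f) (fun k => (hf k).1.deriv) i)
    filter_upwards [h1.eventuallyEq_nhds] with y hy
    exact congrArg (fun L : (Fin N → ℂ) →L[ℂ] ℂ => L (Pi.single i 1)) hy.fderiv_eq
  rw [h2.fderiv_eq, fderiv_sum_comp_dotProduct _ _ _
    fun k => (hf k).1.deriv.deriv.differentiableAt]
  refine Finset.sum_congr rfl fun k _ => ?_
  have h3 := (hf k).2.eq_of_nhds
  simp only [iteratedDeriv_succ, iteratedDeriv_zero] at h3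
  rw [h3]
  ring

/-- The numerator `∑_α c̄_α sin(2 (α, x)) α` of the vector field `e`. -/
def numField (A : TrigConfig N ι) (cbar : ι → ℂ) (x : Fin N → ℂ) : Fin N → ℂ :=
  ∑ k, (cbar k * Complex.sin (2 * (A.vec k ⬝ᵥ x))) • A.vec k

/-- Clears the denominator `H`. This form suffices for `BC_n` and `BC₁`, where no restriction to
mirrors is involved. -/
theorem fieldIsIdentity_of_sum_cot (A : TrigConfig N ι) (cbar : ι → ℂ) (c₀ H₀ : ℂ)
    (hH : ∃ x, A.denom cbar H₀ x ≠ 0)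
    (h : ∀ x, (∀ k, Complex.sin (A.vec k ⬝ᵥ x) ≠ 0) → ∀ i j,
      c₀ * ∑ k, A.mult k * A.vec k i * A.vec k j *
        (Complex.cot (A.vec k ⬝ᵥ x) * (A.vec k ⬝ᵥ A.numField cbar x)) =
      if i = j then A.denom cbar H₀ x else 0) :
    A.FieldIsIdentity cbar c₀ H₀ := by
  refine ⟨hH, fun f x hf hx i j => ?_⟩
  rw [fderiv_partialDeriv_partialDeriv_potential A (fun k => (hf k).2)]
  have h1 := h x (fun k => (hf k).1) i j
  have h2 : A.field cbar c₀ H₀ x = (c₀ * (A.denom cbar H₀ x)⁻¹) • A.numField cbar x := rfl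
  have h3 : ∑ k, A.mult k * A.vec k i * A.vec k j * Complex.cot (A.vec k ⬝ᵥ x) *
      (A.vec k ⬝ᵥ A.field cbar c₀ H₀ x) = (A.denom cbar H₀ x)⁻¹ *
      (c₀ * ∑ k, A.mult k * A.vec k i * A.vec k j *
        (Complex.cot (A.vec k ⬝ᵥ x) * (A.vec k ⬝ᵥ A.numField cbar x))) := by
    rw [h2, Finset.mul_sum, Finset.mul_sum]
    refine Finset.sum_congr rfl fun k _ => ?_
    rw [dotProduct_smul, smul_eq_mul]
    ring
  rw [h3, h1]
  split_ifs
  · exact inv_mul_cancel₀ hx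
  · simp

/-- `T α` is the continuation of `cot (α, x) · (α, V x)`, with `V` the numerator of `e`, across the
mirrors, and with it `e(F_ij) = δ_ij` holds identically. -/
structure IsCotContinuation (A : TrigConfig N ι) (cbar : ι → ℂ) (c₀ H₀ : ℂ)
    (T : ι → (Fin N → ℂ) → ℂ) : Prop where
  sin_mul : ∀ k x, Complex.sin (A.vec k ⬝ᵥ x) * T k x =
    Complex.cos (A.vec k ⬝ᵥ x) * (A.vec k ⬝ᵥ A.numField cbar x)
  sum_eq : ∀ x i j, c₀ * ∑ k, A.mult k * A.vec k i * A.vec k j * T k x =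
    if i = j then A.denom cbar H₀ x else 0

theorem IsCotContinuation.cot_mul {A : TrigConfig N ι} {cbar : ι → ℂ} {c₀ H₀ : ℂ}
    {T : ι → (Fin N → ℂ) → ℂ} (hT : A.IsCotContinuation cbar c₀ H₀ T) {k : ι} {x : Fin N → ℂ}
    (hs : Complex.sin (A.vec k ⬝ᵥ x) ≠ 0) :
    Complex.cot (A.vec k ⬝ᵥ x) * (A.vec k ⬝ᵥ A.numField cbar x) = T k x := by
  rw [Complex.cot_eq_cos_div_sin, div_mul_eq_mul_div, ← hT.sin_mul]
  exact mul_div_cancel_left₀ _ hs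

theorem IsCotContinuation.fieldIsIdentity {A : TrigConfig N ι} {cbar : ι → ℂ} {c₀ H₀ : ℂ}
    {T : ι → (Fin N → ℂ) → ℂ} (hT : A.IsCotContinuation cbar c₀ H₀ T)
    (hH : ∃ x, A.denom cbar H₀ x ≠ 0) : A.FieldIsIdentity cbar c₀ H₀ := by
  refine A.fieldIsIdentity_of_sum_cot cbar c₀ H₀ hH fun x hx i j => ?_
  rw [← hT.sum_eq]
  simp only [hT.cot_mul (hx _)]

/-- A vector annihilated by `sin` is orthogonal to the numerator of `e`. -/
theorem IsCotContinuation.dotProduct_numField_eq_zero {A : TrigConfig N ι} {cbar : ι → ℂ}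
    {c₀ H₀ : ℂ} {T : ι → (Fin N → ℂ) → ℂ} (hT : A.IsCotContinuation cbar c₀ H₀ T) {k : ι}
    {x : Fin N → ℂ} (hx : A.vec k ⬝ᵥ x = 0) : A.vec k ⬝ᵥ A.numField cbar x = 0 := by
  have := hT.sin_mul k x
  rw [hx] at this
  simpa using this.symm

/-! ### Restriction to intersections of mirrors. -/

section Restriction

variable {M : ℕ} {κ : Type} [Fintype κ]

/-- The configuration `B` with multiplicities `b` is the projection of `A` with multiplicities `a`
to the subspace with basis `φ`: the vectors agree up to sign and up to zero vectors. -/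
def ProjectsTo (A : TrigConfig N ι) (a : ι → ℂ) (φ : Fin M → Fin N → ℂ) (B : TrigConfig M κ)
    (b : κ → ℂ) : Prop :=
  ∃ c : ℂ, ∀ g : (Fin M → ℂ) → ℂ, (∀ v, g (-v) = g v) →
    ∑ k, a k * g (fun s => A.vec k ⬝ᵥ φ s) = ∑ l, b l * g (B.vec l) + c * g 0

/-- Complex multiplicities of vectors with the same projection may cancel; natural ones cannot.
Testing on the indicator of `{u, -u}` shows that a nonzero projection `u` really occurs in `B` up to
sign. -/
theorem ProjectsTo.exists_vec_eq {A : TrigConfig N ι} {φ : Fin M → Fin N → ℂ}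
    {B : TrigConfig M κ} {n : ι → ℕ} {b : κ → ℂ} (h : A.ProjectsTo (fun k => (n k : ℂ)) φ B b)
    {k : ι} (hn : n k ≠ 0) (hk : (fun s => A.vec k ⬝ᵥ φ s) ≠ 0) :
    ∃ l, B.vec l = (fun s => A.vec k ⬝ᵥ φ s) ∨ B.vec l = -(fun s => A.vec k ⬝ᵥ φ s) := by
  classical
  by_contra! hne
  obtain ⟨c, hc⟩ := h
  set u : Fin M → ℂ := fun s => A.vec k ⬝ᵥ φ s with hu
  have h1 := hc (fun v => if v = u ∨ v = -u then 1 else 0) fun v => by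
    have : (-v = u ∨ -v = -u) ↔ (v = u ∨ v = -u) := by
      rw [neg_inj, neg_eq_iff_eq_neg, or_comm]
    simp only [this]
  have h2 : ¬((0 : Fin M → ℂ) = u ∨ (0 : Fin M → ℂ) = -u) := by
    rintro (h | h)
    · exact hk h.symm
    · exact hk (neg_eq_zero.1 h.symm)
  have h3 : ∀ l, ¬(B.vec l = u ∨ B.vec l = -u) := fun l h => h.elim (hne l).1 (hne l).2
  simp only [h2, h3, if_false, mul_zero, Finset.sum_const_zero, add_zero] at h1
  -- Read in `ℕ`, a vanishing sum has only vanishing terms.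
  have h4 : ((∑ l, if ((fun s => A.vec l ⬝ᵥ φ s) = u ∨ (fun s => A.vec l ⬝ᵥ φ s) = -u)
      then n l else 0 : ℕ) : ℂ) = 0 := by
    rw [← h1]
    push_cast
    refine Finset.sum_congr rfl fun l _ => ?_
    split_ifs <;> simp
  rw [Nat.cast_eq_zero, Finset.sum_eq_zero_iff] at h4
  have h5 := h4 k (Finset.mem_univ k)
  rw [if_pos (Or.inl rfl)] at h5
  exact hn h5

/-- The point with coordinates `y` in the basis `φ`. -/
def embed (φ : Fin M → Fin N → ℂ) (y : Fin M → ℂ) : Fin N → ℂ := ∑ s, y s • φ s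

theorem dotProduct_embed (φ : Fin M → Fin N → ℂ) (y : Fin M → ℂ) (v : Fin N → ℂ) :
    v ⬝ᵥ embed φ y = (fun s => v ⬝ᵥ φ s) ⬝ᵥ y := by
  rw [embed, dotProduct_sum]
  simp only [dotProduct_smul, smul_eq_mul]
  exact Finset.sum_congr rfl fun s _ => mul_comm _ _

/-- The summand of `H` is even in the vector and vanishes at the zero vector, so neither signs nor
vectors projecting to zero matter. -/
theorem ProjectsTo.denom_embed {A : TrigConfig N ι} {a : ι → ℂ} {φ : Fin M → Fin N → ℂ}
    {B : TrigConfig M κ} {b : κ → ℂ} (h : A.ProjectsTo a φ B b) (H₀ : ℂ) (y : Fin M → ℂ) :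
    A.denom a H₀ (embed φ y) = B.denom b H₀ y := by
  obtain ⟨c, hc⟩ := h
  have := hc (fun v => Complex.sin (v ⬝ᵥ y) ^ 2) fun v => by
    rw [neg_dotProduct, Complex.sin_neg, neg_sq]
  simp only [zero_dotProduct, Complex.sin_zero, ne_eq, OfNat.ofNat_ne_zero, not_false_eq_true,
    zero_pow, mul_zero, add_zero] at this
  simp only [denom, dotProduct_embed, this]

theorem ProjectsTo.numField_embed {A : TrigConfig N ι} {a : ι → ℂ} {φ : Fin M → Fin N → ℂ}
    {B : TrigConfig M κ} {b : κ → ℂ} (h : A.ProjectsTo a φ B b) (y : Fin M → ℂ) (s : Fin M) :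
    A.numField a (embed φ y) ⬝ᵥ φ s = B.numField b y s := by
  obtain ⟨c, hc⟩ := h
  have := hc (fun v => Complex.sin (2 * (v ⬝ᵥ y)) * v s) fun v => by
    rw [neg_dotProduct, mul_neg, Complex.sin_neg, Pi.neg_apply, neg_mul_neg]
  simp only [Pi.zero_apply, mul_zero, add_zero] at this
  simp only [numField, dotProduct_embed, sum_dotProduct, smul_dotProduct, smul_eq_mul,
    Finset.sum_apply, Pi.smul_apply, mul_assoc, this]

/-- If `e(F_ij) = δ_ij` extends across the mirrors for `A`, then it holds for the projections of
`A` to those intersections of mirrors whose orthogonal complement is spanned by the vectors of `A`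
in it. -/
theorem IsCotContinuation.fieldIsIdentity_of_projectsTo {A : TrigConfig N ι} {cbar : ι → ℂ}
    {c₀ H₀ : ℂ} {T : ι → (Fin N → ℂ) → ℂ} (hT : A.IsCotContinuation cbar c₀ H₀ T)
    {φ : Fin M → Fin N → ℂ} {B : TrigConfig M κ} {b bbar : κ → ℂ} {n : ι → ℕ}
    (hn : ∀ k, n k ≠ 0) (hA : A.ProjectsTo (fun k => (n k : ℂ)) φ B b)
    (hm : A.ProjectsTo A.mult φ B B.mult) (hbar : A.ProjectsTo cbar φ B bbar)
    (horth : ∀ s t, φ s ⬝ᵥ φ t = if s = t then 1 else 0)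
    (hspan : ∀ v : Fin N → ℂ, (∀ k, (∀ s, A.vec k ⬝ᵥ φ s = 0) → A.vec k ⬝ᵥ v = 0) →
      v = ∑ s, (v ⬝ᵥ φ s) • φ s)
    (hH : ∃ y, A.denom cbar H₀ (embed φ y) ≠ 0) : B.FieldIsIdentity bbar c₀ H₀ := by
  refine B.fieldIsIdentity_of_sum_cot bbar c₀ H₀
    (hH.imp fun y hy => by rwa [hbar.denom_embed] at hy) fun y hy i j => ?_
  -- At `x` the field `V` is orthogonal to every vector of `A` that vanishes on the subspace. By
  -- `hspan` it is therefore tangent, and its coordinates are those of the field of `B`.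
  set x := embed φ y with hx
  have hV : ∀ k, A.vec k ⬝ᵥ A.numField cbar x =
      (fun s => A.vec k ⬝ᵥ φ s) ⬝ᵥ B.numField bbar y := by
    intro k
    have h1 := hspan (A.numField cbar x) fun k hk => hT.dotProduct_numField_eq_zero (by
      rw [hx, dotProduct_embed, show (fun s => A.vec k ⬝ᵥ φ s) = 0 from funext hk,
        zero_dotProduct])
    rw [← dotProduct_embed]
    congr 1
    rw [h1]
    simp only [hx, hbar.numField_embed]
    rfl
  obtain ⟨c, hc⟩ := hm
  have h1 := hc (fun v => v i * v j * (Complex.cot (v ⬝ᵥ y) * (v ⬝ᵥ B.numField bbar y))) fun v => by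
    simp only [Complex.cot_eq_cos_div_sin, neg_dotProduct, Complex.sin_neg, Complex.cos_neg,
      Pi.neg_apply, div_neg]
    ring
  simp only [Pi.zero_apply, mul_zero, zero_mul, add_zero] at h1
  have h2 : ∀ k, A.mult k * ((A.vec k ⬝ᵥ φ i) * (A.vec k ⬝ᵥ φ j) *
      (Complex.cot ((fun s => A.vec k ⬝ᵥ φ s) ⬝ᵥ y) *
        ((fun s => A.vec k ⬝ᵥ φ s) ⬝ᵥ B.numField bbar y))) =
      A.mult k * (A.vec k ⬝ᵥ φ i) * (A.vec k ⬝ᵥ φ j) * T k x := by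
    intro k
    by_cases hk : (fun s => A.vec k ⬝ᵥ φ s) = 0
    · have := congrFun hk i
      simp only [Pi.zero_apply] at this
      simp only [this, zero_mul, mul_zero]
    · have hs : Complex.sin (A.vec k ⬝ᵥ x) ≠ 0 := by
        rw [hx, dotProduct_embed]
        obtain ⟨l, hl | hl⟩ := hA.exists_vec_eq (hn k) hk
        · rw [← hl]
          exact hy l
        · rw [← neg_ne_zero, ← Complex.sin_neg, ← neg_dotProduct, ← hl]
          exact hy l
      rw [← hV, ← dotProduct_embed, ← hx, hT.cot_mul hs]
      ring
  simp only [h2] at h1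
  have h3 : ∑ k, B.mult k * B.vec k i * B.vec k j *
      (Complex.cot (B.vec k ⬝ᵥ y) * (B.vec k ⬝ᵥ B.numField bbar y)) =
      ∑ k, A.mult k * (A.vec k ⬝ᵥ φ i) * (A.vec k ⬝ᵥ φ j) * T k x := by
    rw [h1]
    exact Finset.sum_congr rfl fun k _ => by ring
  -- The matrix identity for `A` is contracted with `φ i` and `φ j`; orthonormality turns `H` times
  -- the identity of size `N` into that of size `M`.
  have h4 : c₀ * ∑ k, A.mult k * (A.vec k ⬝ᵥ φ i) * (A.vec k ⬝ᵥ φ j) * T k x =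
      ∑ p, ∑ q, φ i p * φ j q * (c₀ * ∑ k, A.mult k * A.vec k p * A.vec k q * T k x) := by
    simp only [Finset.mul_sum]
    rw [(Finset.sum_congr rfl fun p _ => Finset.sum_comm).trans Finset.sum_comm]
    refine Finset.sum_congr rfl fun k _ => ?_
    have h5 : c₀ * (A.mult k * (A.vec k ⬝ᵥ φ i) * (A.vec k ⬝ᵥ φ j) * T k x) =
        c₀ * A.mult k * T k x * ((A.vec k ⬝ᵥ φ i) * (A.vec k ⬝ᵥ φ j)) := by ring
    rw [h5, dotProduct, dotProduct, Finset.sum_mul_sum, Finset.mul_sum]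
    refine Finset.sum_congr rfl fun p _ => ?_
    rw [Finset.mul_sum]
    exact Finset.sum_congr rfl fun q _ => by ring
  rw [h3, h4]
  simp only [hT.sum_eq, mul_ite, mul_zero, Finset.sum_ite_eq, Finset.mem_univ, if_true]
  rw [← Finset.sum_mul, ← hbar.denom_embed H₀ y]
  have := horth i j
  rw [dotProduct] at this
  rw [this]
  split_ifs <;> simp [hx]

end Restriction

end TrigConfig

end

/-! ### `F₄`: cancellation of the poles. -/

noncomputable section

open Complex (sin cos)

namespace F4

/-- A component of the numerator of `e` for `F₄`, at the coordinate `a`. -/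
def num (r l a b c d : ℂ) : ℂ :=
  r * (2 * (sin a * cos a) + 4 * (sin a * cos b * cos c * cos d)) +
    2 * l * (sin (2 * a) * (cos (2 * b) + cos (2 * c) + cos (2 * d)))

/-- The function `cot (α, x) (α, V x)` for `α` a standard basis vector. -/
def cotBasis (r l a b c d : ℂ) : ℂ :=
  r * (1 + cos (2 * a) + 4 * (cos a * cos b * cos c * cos d)) +
    2 * l * ((1 + cos (2 * a)) * (cos (2 * b) + cos (2 * c) + cos (2 * d)))

/-- The function `cot (α, x) (α, V x)` for `α` a sum of two basis vectors. -/
def cotLong (r l a b c d : ℂ) : ℂ :=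
  r * (cos (2 * a) + cos (2 * b) + 4 * (cos (a + b) * cos c * cos d)) +
    2 * l * (1 + cos (2 * a + 2 * b) +
      (cos (2 * a) + cos (2 * b)) * (cos (2 * c) + cos (2 * d)))

/-- The function `cot (α, x) (α, V x)` for `α` half the sum of the basis vectors. -/
def cotHalf (r l a b c d : ℂ) : ℂ :=
  r * (1 + cos (a + b + c + d) + (cos (2 * a) + cos (2 * b) + cos (2 * c) + cos (2 * d)) / 2 +
    (cos (a + b) * cos (c - d) + cos (c + d) * cos (a - b))) +
  l * (2 * (cos (a + b - (c + d)) + cos (a - b + (c - d)) + cos (a - b - (c - d))) +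
    (cos (2 * a + 2 * b) + cos (2 * c + 2 * d) + cos (2 * a + 2 * c) + cos (2 * b + 2 * d) +
      cos (2 * a + 2 * d) + cos (2 * b + 2 * c)))

/-- Every term of `num` contains `sin a` or `sin (2 * a)`. Here `l` is the value of `c̄` on long
roots: `q` in the first case, `0` in the second. -/
theorem sin_mul_cotBasis (r l a b c d : ℂ) :
    sin a * cotBasis r l a b c d = cos a * num r l a b c d := by
  rw [cotBasis, num, Complex.cos_two_mul a, Complex.sin_two_mul a]
  ring

theorem sin_two_mul_add_sin_two_mul (a b : ℂ) :
    sin (2 * a) + sin (2 * b) = 2 * (sin (a + b) * cos (a - b)) := by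
  rw [Complex.sin_add_sin]
  ring_nf

theorem cos_two_mul_add_cos_two_mul (a b : ℂ) :
    cos (2 * a) + cos (2 * b) = 2 * (cos (a + b) * cos (a - b)) := by
  rw [Complex.cos_add_cos]
  ring_nf

/-- The sum of two components is built from `sin 2a + sin 2b`, `sin a cos b + cos a sin b` and `sin
(2a + 2b)`, each divisible by `sin (a + b)`. -/
theorem sin_mul_cotLong (r l a b c d : ℂ) :
    sin (a + b) * cotLong r l a b c d = cos (a + b) * (num r l a b c d + num r l b a c d) := by
  have h1 := sin_two_mul_add_sin_two_mul a b
  have h2 := cos_two_mul_add_cos_two_mul a b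
  have h3 : cos (2 * a + 2 * b) = 2 * cos (a + b) ^ 2 - 1 := by
    rw [← mul_add, Complex.cos_two_mul]
  have h4 : sin (2 * a) * cos (2 * b) + cos (2 * a) * sin (2 * b) =
      2 * sin (a + b) * cos (a + b) := by
    rw [← Complex.sin_add, ← mul_add, Complex.sin_two_mul]
  have h5 := Complex.sin_add a b
  rw [Complex.sin_two_mul a, Complex.sin_two_mul b] at h1
  have h1' := sin_two_mul_add_sin_two_mul a b
  rw [cotLong, num, num, h3]
  linear_combination (r * sin (a + b) + 2 * l * sin (a + b) * (cos (2 * c) + cos (2 * d))) * h2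
    - r * cos (a + b) * h1 - 2 * l * cos (a + b) * (cos (2 * c) + cos (2 * d)) * h1'
    - 2 * l * cos (a + b) * h4 + 4 * r * cos (a + b) * cos c * cos d * h5

/-- Half the Hadamard matrix of order 4 is an orthogonal symmetry of `F₄` that exchanges
`(e₁+e₂+e₃+e₄)/2` and `e₁`. Being an involution, it expresses `a, b, c, d` by `y, z, u, v` through
the same formulas. -/
theorem cotHalf_eq_cotBasis (r l a b c d : ℂ) :
    cotHalf r l a b c d = cotBasis r l ((a + b + c + d) / 2) ((a + b - (c + d)) / 2)
      ((a - b + (c - d)) / 2) ((a - b - (c - d)) / 2) := by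
  obtain ⟨y, z, u, v, ha, hb, hc, hd⟩ : ∃ y z u v : ℂ, a = (y + z + (u + v)) / 2 ∧
      b = (y + z - (u + v)) / 2 ∧ c = (y - z + (u - v)) / 2 ∧ d = (y - z - (u - v)) / 2 :=
    ⟨(a + b + c + d) / 2, (a + b - (c + d)) / 2, (a - b + (c - d)) / 2, (a - b - (c - d)) / 2,
      by ring, by ring, by ring, by ring⟩
  have e1 : (a + b + c + d) / 2 = y := by rw [ha, hb, hc, hd]; ring
  have e2 : (a + b - (c + d)) / 2 = z := by rw [ha, hb, hc, hd]; ring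
  have e3 : (a - b + (c - d)) / 2 = u := by rw [ha, hb, hc, hd]; ring
  have e4 : (a - b - (c - d)) / 2 = v := by rw [ha, hb, hc, hd]; ring
  have f1 : a + b = y + z := by rw [ha, hb]; ring
  have f2 : c + d = y - z := by rw [hc, hd]; ring
  have f3 : a - b = u + v := by rw [ha, hb]; ring
  have f4 : c - d = u - v := by rw [hc, hd]; ring
  have g1 := cos_two_mul_add_cos_two_mul a b
  have g2 := cos_two_mul_add_cos_two_mul c d
  rw [f1, f3] at g1
  rw [f2, f4] at g2
  have k1 : 2 * a + 2 * b = 2 * y + 2 * z := by rw [ha, hb]; ring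
  have k2 : 2 * c + 2 * d = 2 * y - 2 * z := by rw [hc, hd]; ring
  have k3 : 2 * a + 2 * c = 2 * y + 2 * u := by rw [ha, hc]; ring
  have k4 : 2 * b + 2 * d = 2 * y - 2 * u := by rw [hb, hd]; ring
  have k5 : 2 * a + 2 * d = 2 * y + 2 * v := by rw [ha, hd]; ring
  have k6 : 2 * b + 2 * c = 2 * y - 2 * v := by rw [hb, hc]; ring
  rw [e1, e2, e3, e4, cotHalf, cotBasis, k1, k2, k3, k4, k5, k6, f1, f2, f3, f4,
    show y + z + c + d = 2 * y by rw [hc, hd]; ring, show y + z - (y - z) = 2 * z by ring,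
    show u + v + (u - v) = 2 * u by ring, show u + v - (u - v) = 2 * v by ring]
  simp only [Complex.cos_add, Complex.cos_sub] at g1 g2 ⊢
  linear_combination r / 2 * g1 + r / 2 * g2

/-- `V` is equivariant under the same symmetry, so its component along the half-sum root is a basis
component in the new coordinates. -/
theorem num_add_num_add_num_add_num (r l a b c d : ℂ) :
    (num r l a b c d + num r l b a c d + num r l c a b d + num r l d a b c) / 2 =
      num r l ((a + b + c + d) / 2) ((a + b - (c + d)) / 2)
      ((a - b + (c - d)) / 2) ((a - b - (c - d)) / 2) := by
  obtain ⟨y, z, u, v, ha, hb, hc, hd⟩ : ∃ y z u v : ℂ, a = (y + z + (u + v)) / 2 ∧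
      b = (y + z - (u + v)) / 2 ∧ c = (y - z + (u - v)) / 2 ∧ d = (y - z - (u - v)) / 2 :=
    ⟨(a + b + c + d) / 2, (a + b - (c + d)) / 2, (a - b + (c - d)) / 2, (a - b - (c - d)) / 2,
      by ring, by ring, by ring, by ring⟩
  have e1 : (a + b + c + d) / 2 = y := by rw [ha, hb, hc, hd]; ring
  have e2 : (a + b - (c + d)) / 2 = z := by rw [ha, hb, hc, hd]; ring
  have e3 : (a - b + (c - d)) / 2 = u := by rw [ha, hb, hc, hd]; ring
  have e4 : (a - b - (c - d)) / 2 = v := by rw [ha, hb, hc, hd]; ring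
  have f1 : a + b = y + z := by rw [ha, hb]; ring
  have f2 : c + d = y - z := by rw [hc, hd]; ring
  have f3 : a - b = u + v := by rw [ha, hb]; ring
  have f4 : c - d = u - v := by rw [hc, hd]; ring
  have k1 : 2 * a + 2 * b = 2 * y + 2 * z := by rw [ha, hb]; ring
  have k2 : 2 * c + 2 * d = 2 * y - 2 * z := by rw [hc, hd]; ring
  have k3 : 2 * a + 2 * c = 2 * y + 2 * u := by rw [ha, hc]; ring
  have k4 : 2 * b + 2 * d = 2 * y - 2 * u := by rw [hb, hd]; ring
  have k5 : 2 * a + 2 * d = 2 * y + 2 * v := by rw [ha, hd]; ring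
  have k6 : 2 * b + 2 * c = 2 * y - 2 * v := by rw [hb, hc]; ring
  have p1 := Complex.sin_add (2 * a) (2 * b)
  have p2 := Complex.sin_add (2 * c) (2 * d)
  have p3 := Complex.sin_add (2 * a) (2 * c)
  have p4 := Complex.sin_add (2 * b) (2 * d)
  have p5 := Complex.sin_add (2 * a) (2 * d)
  have p6 := Complex.sin_add (2 * b) (2 * c)
  rw [k1] at p1
  rw [k2] at p2
  rw [k3] at p3
  rw [k4] at p4
  rw [k5] at p5
  rw [k6] at p6
  have s1 := sin_two_mul_add_sin_two_mul a b
  have s2 := sin_two_mul_add_sin_two_mul c d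
  have t1 := Complex.sin_add a b
  have t2 := Complex.sin_add c d
  have w1 : 2 * (cos a * cos b) = cos (a + b) + cos (a - b) := by
    rw [Complex.cos_add, Complex.cos_sub]; ring
  have w2 : 2 * (cos c * cos d) = cos (c + d) + cos (c - d) := by
    rw [Complex.cos_add, Complex.cos_sub]; ring
  rw [f1] at t1
  rw [f2] at t2
  rw [f1, f3] at w1
  rw [f2, f4] at w2
  rw [f1, f3] at s1
  rw [f2, f4] at s2
  rw [Complex.sin_two_mul, Complex.sin_two_mul] at s1 s2
  simp only [e1, e2, e3, e4, num]
  have m1 : 4 * (sin a * cos b * cos c * cos d + sin b * cos a * cos c * cos d +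
      sin c * cos a * cos b * cos d + sin d * cos a * cos b * cos c) =
      2 * (sin (y + z) * (cos (y - z) + cos (u - v)) +
        sin (y - z) * (cos (y + z) + cos (u + v))) := by
    rw [t1, t2, ← w1, ← w2]; ring
  have m2 : sin (y + z) * cos (y - z) + sin (y - z) * cos (y + z) = 2 * sin y * cos y := by
    rw [← Complex.sin_two_mul, show 2 * y = y + z + (y - z) by ring, Complex.sin_add (y + z)]
    ring
  simp only [Complex.sin_add, Complex.sin_sub, Complex.cos_add, Complex.cos_sub]
    at p1 p2 p3 p4 p5 p6 s1 s2 m1 m2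
  linear_combination r / 2 * (s1 + s2 + m1) + r * m2 - l * (p1 + p2 + p3 + p4 + p5 + p6)

theorem sin_mul_cotHalf (r l a b c d : ℂ) :
    sin ((a + b + c + d) / 2) * cotHalf r l a b c d = cos ((a + b + c + d) / 2) *
      ((num r l a b c d + num r l b a c d + num r l c a b d + num r l d a b c) / 2) := by
  rw [cotHalf_eq_cotBasis, num_add_num_add_num_add_num, sin_mul_cotBasis]

/-- The trigonometric polynomials `cot (α, x) (α, V x)`. -/
def cotPoly (r l : ℂ) (k : Fin 24) (x : Fin 4 → ℂ) : ℂ :=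
  ![
    cotBasis r l (x 0) (x 1) (x 2) (x 3), cotBasis r l (x 1) (x 0) (x 2) (x 3),
    cotBasis r l (x 2) (x 0) (x 1) (x 3), cotBasis r l (x 3) (x 0) (x 1) (x 2),
    cotLong r l (x 0) (x 1) (x 2) (x 3), cotLong r l (x 0) (-x 1) (x 2) (x 3),
    cotLong r l (x 0) (x 2) (x 1) (x 3), cotLong r l (x 0) (-x 2) (x 1) (x 3),
    cotLong r l (x 0) (x 3) (x 1) (x 2), cotLong r l (x 0) (-x 3) (x 1) (x 2),
    cotLong r l (x 1) (x 2) (x 0) (x 3), cotLong r l (x 1) (-x 2) (x 0) (x 3),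
    cotLong r l (x 1) (x 3) (x 0) (x 2), cotLong r l (x 1) (-x 3) (x 0) (x 2),
    cotLong r l (x 2) (x 3) (x 0) (x 1), cotLong r l (x 2) (-x 3) (x 0) (x 1),
    cotHalf r l (x 0) (x 1) (x 2) (x 3), cotHalf r l (x 0) (x 1) (x 2) (-x 3),
    cotHalf r l (x 0) (x 1) (-x 2) (x 3), cotHalf r l (x 0) (x 1) (-x 2) (-x 3),
    cotHalf r l (x 0) (-x 1) (x 2) (x 3), cotHalf r l (x 0) (-x 1) (x 2) (-x 3),
    cotHalf r l (x 0) (-x 1) (-x 2) (x 3), cotHalf r l (x 0) (-x 1) (-x 2) (-x 3)] k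

theorem vec_dotProduct (q r : ℂ) (k : Fin 24) (y : Fin 4 → ℂ) :
    (configF4 q r).vec k ⬝ᵥ y = ![
      y 0, y 1, y 2, y 3, y 0 + y 1, y 0 + -y 1, y 0 + y 2, y 0 + -y 2, y 0 + y 3, y 0 + -y 3,
      y 1 + y 2, y 1 + -y 2, y 1 + y 3, y 1 + -y 3, y 2 + y 3, y 2 + -y 3,
      (y 0 + y 1 + y 2 + y 3) / 2, (y 0 + y 1 + y 2 + -y 3) / 2, (y 0 + y 1 + -y 2 + y 3) / 2,
      (y 0 + y 1 + -y 2 + -y 3) / 2, (y 0 + -y 1 + y 2 + y 3) / 2, (y 0 + -y 1 + y 2 + -y 3) / 2,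
      (y 0 + -y 1 + -y 2 + y 3) / 2, (y 0 + -y 1 + -y 2 + -y 3) / 2] k := by
  fin_cases k <;> simp [configF4, dotProduct, Fin.sum_univ_four] <;> ring

theorem numField_eq (q l r : ℂ) (x : Fin 4 → ℂ) :
    (configF4 q r).numField (configF4 l r).mult x =
      ![num r l (x 0) (x 1) (x 2) (x 3), num r l (x 1) (x 0) (x 2) (x 3),
        num r l (x 2) (x 0) (x 1) (x 3), num r l (x 3) (x 0) (x 1) (x 2)] := by
  have h (a b : ℂ) : sin (2 * (a + b)) = sin (2 * a) * cos (2 * b) + cos (2 * a) * sin (2 * b) := by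
    rw [mul_add, Complex.sin_add]
  have h' (a : ℂ) : sin (2 * (a / 2)) = sin a := by rw [mul_div_cancel₀ a two_ne_zero]
  funext i
  simp only [TrigConfig.numField, vec_dotProduct, Finset.sum_apply, Pi.smul_apply, smul_eq_mul]
  fin_cases i <;>
  · simp [configF4, Fin.sum_univ_succ, h, h', num, Complex.sin_add, Complex.cos_add, -mul_eq_mul_left_iff]
    simp only [Complex.sin_two_mul]
    ring

end F4

end

/-! ### `F₄`: the summed identity. -/

noncomputable section

open Complex (sin cos)

namespace F4

theorem denom_eq (q l r H₀ : ℂ) (x : Fin 4 → ℂ) :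
    (configF4 q r).denom (configF4 l r).mult H₀ x = H₀ + (12 * r + 12 * l) / 2 -
      r / 2 * (cos (2 * x 0) + cos (2 * x 1) + cos (2 * x 2) + cos (2 * x 3) +
        8 * (cos (x 0) * cos (x 1) * cos (x 2) * cos (x 3))) -
      l * (cos (2 * x 0) * cos (2 * x 1) + cos (2 * x 0) * cos (2 * x 2) +
        cos (2 * x 0) * cos (2 * x 3) + cos (2 * x 1) * cos (2 * x 2) +
        cos (2 * x 1) * cos (2 * x 3) + cos (2 * x 2) * cos (2 * x 3)) := by
  have h1 (z : ℂ) : sin z ^ 2 = (1 - cos (2 * z)) / 2 := by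
    rw [Complex.cos_two_mul, Complex.cos_sq']; ring
  have h (a b : ℂ) : cos (2 * (a + b)) = cos (2 * a) * cos (2 * b) - sin (2 * a) * sin (2 * b) := by
    rw [mul_add, Complex.cos_add]
  have h' (a : ℂ) : cos (2 * (a / 2)) = cos a := by rw [mul_div_cancel₀ a two_ne_zero]
  simp only [TrigConfig.denom, vec_dotProduct, h1]
  simp [configF4, Fin.sum_univ_succ, h, h', Complex.sin_add, Complex.cos_add]
  ring

theorem sin_mul_cotPoly (q l r : ℂ) (k : Fin 24) (x : Fin 4 → ℂ) :
    sin ((configF4 q r).vec k ⬝ᵥ x) * cotPoly r l k x = cos ((configF4 q r).vec k ⬝ᵥ x) *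
      ((configF4 q r).vec k ⬝ᵥ (configF4 q r).numField (configF4 l r).mult x) := by
  rw [vec_dotProduct, vec_dotProduct, numField_eq, cotPoly]
  fin_cases k
  iterate 4 exact sin_mul_cotBasis r l _ _ _ _
  iterate 12
    simp only [Fin.reduceFinMk, Matrix.cons_val]
    refine (sin_mul_cotLong r l _ _ _ _).trans ?_
    simp only [num, mul_neg, Complex.sin_neg, Complex.cos_neg] <;> ring
  all_goals
    simp only [Fin.reduceFinMk, Matrix.cons_val]
    refine (sin_mul_cotHalf r l _ _ _ _).trans ?_
    simp only [num, mul_neg, Complex.sin_neg, Complex.cos_neg] <;> ring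

-- In entry `(0, 0)` the coefficient of `cos 2x₀` is `2r² + 6qr` and that of `cos 2x₁` is `r² + 2qr
-- + 2lr`. In `H` they are equal, which for `r ≠ 0` means `r = 2l - 4q`: `-2q` for `l = q` and `-4q`
-- for `l = 0`.
set_option maxHeartbeats 1000000 in
theorem sum_cotPoly_of_eq_neg_two_mul {q r : ℂ} (hr : r = -2 * q) (x : Fin 4 → ℂ)
    (i j : Fin 4) :
    ∑ k, (configF4 q r).mult k * (configF4 q r).vec k i * (configF4 q r).vec k j *
      cotPoly r q k x = -4 * q *
        if i = j then (configF4 q r).denom (configF4 q r).mult 0 x else 0 := by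
  rw [denom_eq, hr]
  fin_cases i <;> fin_cases j
  all_goals
    simp [configF4, Fin.sum_univ_succ, -mul_eq_zero, -mul_eq_mul_left_iff,
      -mul_eq_mul_right_iff, -neg_eq_zero]
    simp only [cotPoly, Matrix.cons_val, cotBasis, cotLong, cotHalf]
    -- The addition formulas suffice: the sines and cosines of `x i` and of `2 * x i` are then
    -- independent symbols of a polynomial identity.
    simp only [Complex.cos_add, Complex.sin_add, Complex.cos_sub, Complex.sin_sub, mul_neg,
      Complex.sin_neg, Complex.cos_neg]
    ring

theorem isCotContinuation_of_eq_neg_two_mul {q r : ℂ} (hr : r = -2 * q) (hq : q ≠ 0) :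
    (configF4 q r).IsCotContinuation (configF4 q r).mult (-1 / (4 * q)) 0 (cotPoly r q) := by
  refine ⟨sin_mul_cotPoly q q r, fun x i j => ?_⟩
  rw [sum_cotPoly_of_eq_neg_two_mul hr]
  field_simp

-- The constant terms fix `H₀`: a diagonal entry has constant term `3r² = 48q²`, and `4q (H₀ + 6r)`
-- must equal it, whence `H₀ = 36q`.
set_option maxHeartbeats 1000000 in
theorem sum_cotPoly_of_eq_neg_four_mul {q r : ℂ} (hr : r = -4 * q) (x : Fin 4 → ℂ)
    (i j : Fin 4) :
    ∑ k, (configF4 q r).mult k * (configF4 q r).vec k i * (configF4 q r).vec k j *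
      cotPoly r 0 k x = 4 * q *
        if i = j then (configF4 q r).denom (configF4 0 r).mult (36 * q) x else 0 := by
  rw [denom_eq, hr]
  fin_cases i <;> fin_cases j
  all_goals
    simp [configF4, Fin.sum_univ_succ, -mul_eq_zero, -mul_eq_mul_left_iff,
      -mul_eq_mul_right_iff, -neg_eq_zero]
    simp only [cotPoly, Matrix.cons_val, cotBasis, cotLong, cotHalf]
    simp only [Complex.cos_add, Complex.sin_add, Complex.cos_sub, Complex.sin_sub, mul_neg,
      Complex.sin_neg, Complex.cos_neg]
    ring

theorem isCotContinuation_of_eq_neg_four_mul {q r : ℂ} (hr : r = -4 * q) (hq : q ≠ 0) :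
    (configF4 q r).IsCotContinuation (configF4 0 r).mult (1 / (4 * q)) (36 * q) (cotPoly r 0) := by
  refine ⟨sin_mul_cotPoly q 0 r, fun x i j => ?_⟩
  rw [sum_cotPoly_of_eq_neg_four_mul hr]
  field_simp

end F4

end

/-! ### Projections of `F₄`. -/

noncomputable section

theorem sqrtTwo_mul_self : sqrtTwo * sqrtTwo = 2 := by
  rw [sqrtTwo, ← Complex.ofReal_mul, Real.mul_self_sqrt (by norm_num)]; norm_num

theorem sqrtThree_mul_self : sqrtThree * sqrtThree = 3 := by
  rw [sqrtThree, ← Complex.ofReal_mul, Real.mul_self_sqrt (by norm_num)]; norm_num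

theorem sqrtSix_mul_self : sqrtSix * sqrtSix = 6 := by
  rw [sqrtSix, ← Complex.ofReal_mul, Real.mul_self_sqrt (by norm_num)]; norm_num

theorem sqrtTwo_ne_zero : sqrtTwo ≠ 0 := by
  intro h; have := sqrtTwo_mul_self; norm_num [h] at this

theorem sqrtThree_ne_zero : sqrtThree ≠ 0 := by
  intro h; have := sqrtThree_mul_self; norm_num [h] at this

theorem sqrtSix_ne_zero : sqrtSix ≠ 0 := by
  intro h; have := sqrtSix_mul_self; norm_num [h] at this

theorem inv_sqrtTwo : sqrtTwo⁻¹ = sqrtTwo / 2 := by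
  refine inv_eq_of_mul_eq_one_left ?_
  linear_combination sqrtTwo_mul_self / 2

theorem dotProduct_cons_cons (v a b : Fin 4 → ℂ) :
    (fun s => v ⬝ᵥ (![a, b] : Fin 2 → Fin 4 → ℂ) s) = ![v ⬝ᵥ a, v ⬝ᵥ b] := by
  ext s; fin_cases s <;> rfl

theorem dotProduct_cons_cons_cons (v a b c : Fin 4 → ℂ) :
    (fun s => v ⬝ᵥ (![a, b, c] : Fin 3 → Fin 4 → ℂ) s) = ![v ⬝ᵥ a, v ⬝ᵥ b, v ⬝ᵥ c] := by
  ext s; fin_cases s <;> rfl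

namespace F4

/-- With `H₀ = 0` the origin is a zero of `H`, so another point is needed. The first point lies in
every subspace used except the plane of `(F₄, A₂)₂`, which contains the second. -/
theorem denom_ne_zero_of_eq_neg_two_mul {q r : ℂ} (hr : r = -2 * q) (hq : q ≠ 0)
    {x : Fin 4 → ℂ} (hx : x = ![(Real.pi : ℂ) / 2, 0, 0, 0] ∨ x = ![(Real.pi : ℂ) / 2, (Real.pi : ℂ) / 2, 0, 0]) :
    (configF4 q r).denom (configF4 q r).mult 0 x ≠ 0 := by
  have h1 : 2 * ((Real.pi : ℂ) / 2) = Real.pi := by ring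
  have h2 : (configF4 q r).denom (configF4 q r).mult 0 x = -4 * q := by
    rcases hx with rfl | rfl <;> rw [denom_eq, hr] <;> simp [h1] <;> ring
  rw [h2]
  exact mul_ne_zero (by norm_num) hq

section Projection

variable {M : ℕ} {κ : Type} [Fintype κ] {φ : Fin M → Fin 4 → ℂ} {B : ℂ → ℂ → TrigConfig M κ}

/-- Both cases of `e(F_ij) = δ_ij` for `F₄` descend to projections. -/
theorem fieldIsIdentity_projection
    (hB : ∀ q r, (configF4 q r).ProjectsTo (configF4 q r).mult φ (B q r) (B q r).mult)
    (hvec : ∀ q r, (B q r).vec = (B 0 0).vec)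
    (horth : ∀ s t, φ s ⬝ᵥ φ t = if s = t then 1 else 0)
    (hspan : ∀ v : Fin 4 → ℂ,
      (∀ k, (∀ s, (configF4 0 0).vec k ⬝ᵥ φ s = 0) → (configF4 0 0).vec k ⬝ᵥ v = 0) →
      v = ∑ s, (v ⬝ᵥ φ s) • φ s)
    (hy : ∃ y, TrigConfig.embed φ y = ![(Real.pi : ℂ) / 2, 0, 0, 0] ∨
      TrigConfig.embed φ y = ![(Real.pi : ℂ) / 2, (Real.pi : ℂ) / 2, 0, 0]) {q r : ℂ} (h0 : r ≠ 0) :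
    (r = -2 * q → (B q r).FieldIsIdentity (B q r).mult (-1 / (4 * q)) 0) ∧
    (r = -4 * q → (B q r).FieldIsIdentity (B 0 r).mult (1 / (4 * q)) (36 * q)) := by
  -- Multiplicities are specialised to `q = r = 1` to track which vectors occur: the actual ones,
  -- such as `r + 2q` or `r + 4q`, can vanish in the cases at hand.
  have h1 : (configF4 q r).ProjectsTo (fun _ => ((1 : ℕ) : ℂ)) φ (B q r) (B 1 1).mult := by
    obtain ⟨c, hc⟩ := hB 1 1
    refine ⟨c, fun g hg => ?_⟩
    rw [hvec, ← hvec 1 1, ← hc g hg]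
    refine Finset.sum_congr rfl fun k _ => congrArg (· * _) ?_
    fin_cases k <;> simp [configF4]
  refine ⟨fun hr => ?_, fun hr => ?_⟩
  · have hq : q ≠ 0 := by rintro rfl; simp [hr] at h0
    exact (isCotContinuation_of_eq_neg_two_mul hr hq).fieldIsIdentity_of_projectsTo
      (fun _ => one_ne_zero) h1 (hB q r) (hB q r) horth hspan
      (hy.imp fun y hy => denom_ne_zero_of_eq_neg_two_mul hr hq hy)
  · have hq : q ≠ 0 := by rintro rfl; simp [hr] at h0
    have h2 : (configF4 q r).ProjectsTo (configF4 0 r).mult φ (B q r) (B 0 r).mult := by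
      obtain ⟨c, hc⟩ := hB 0 r
      refine ⟨c, fun g hg => ?_⟩
      rw [hvec, ← hvec 0 r, ← hc g hg]
      rfl
    refine (isCotContinuation_of_eq_neg_four_mul hr hq).fieldIsIdentity_of_projectsTo
      (fun _ => one_ne_zero) h1 (hB q r) h2 horth hspan ⟨0, ?_⟩
    simpa [TrigConfig.denom, TrigConfig.embed] using hq

end Projection

theorem fieldIsIdentity {q r : ℂ} (h0 : r ≠ 0) :
    (r = -2 * q → (configF4 q r).FieldIsIdentity (configF4 q r).mult (-1 / (4 * q)) 0) ∧
    (r = -4 * q →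
      (configF4 q r).FieldIsIdentity (configF4 0 r).mult (1 / (4 * q)) (36 * q)) := by
  refine ⟨fun hr => ?_, fun hr => ?_⟩
  · have hq : q ≠ 0 := by rintro rfl; simp [hr] at h0
    exact (isCotContinuation_of_eq_neg_two_mul hr hq).fieldIsIdentity
      ⟨_, denom_ne_zero_of_eq_neg_two_mul hr hq (Or.inl rfl)⟩
  · have hq : q ≠ 0 := by rintro rfl; simp [hr] at h0
    exact (isCotContinuation_of_eq_neg_four_mul hr hq).fieldIsIdentity
      ⟨0, by simpa [TrigConfig.denom] using hq⟩

theorem fieldIsIdentity_A1one {q r : ℂ} (h0 : r ≠ 0) :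
    (r = -2 * q → (configF4A1one q r).FieldIsIdentity (configF4A1one q r).mult (-1 / (4 * q)) 0) ∧
    (r = -4 * q →
      (configF4A1one q r).FieldIsIdentity (configF4A1one 0 r).mult (1 / (4 * q)) (36 * q)) := by
  refine fieldIsIdentity_projection (φ := ![![1, 0, 0, 0], ![0, 1, 0, 0], ![0, 0, 1, 0]])
    -- The witness is the multiplicity of the zero vector, that is, of the positive roots orthogonal
    -- to the subspace; here only `e₄`.
    (fun q r => ⟨r + 0 * q, fun g hg => ?_⟩) (fun _ _ => rfl) (fun s t => ?_) (fun v hv => ?_)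
    ⟨![(Real.pi : ℂ) / 2, 0, 0], Or.inl ?_⟩ h0
  · simp only [dotProduct_cons_cons_cons]
    rw [show (0 : Fin 3 → ℂ) = ![0, 0, 0] by ext s; fin_cases s <;> rfl]
    simp [configF4, dotProduct, configF4A1one, Fin.sum_univ_succ]
    ring
  · fin_cases s <;> fin_cases t <;> simp [dotProduct, Fin.sum_univ_succ]
  -- Index `3` is `e₄`. In each projection the indices given to `hv` select roots that span the
  -- orthogonal complement.
  · have h1 := hv 3 fun s => by
      fin_cases s <;> simp [configF4, dotProduct, Fin.sum_univ_succ]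
    simp [configF4, dotProduct, Fin.sum_univ_four] at h1
    ext p
    fin_cases p <;> simp [dotProduct, Fin.sum_univ_four, Fin.sum_univ_three, h1]
  · ext p
    fin_cases p <;> simp [TrigConfig.embed, Fin.sum_univ_three]

theorem fieldIsIdentity_A1two {q r : ℂ} (h0 : r ≠ 0) :
    (r = -2 * q → (configF4A1two q r).FieldIsIdentity (configF4A1two q r).mult (-1 / (4 * q)) 0) ∧
    (r = -4 * q →
      (configF4A1two q r).FieldIsIdentity (configF4A1two 0 r).mult (1 / (4 * q)) (36 * q)) := by
  refine fieldIsIdentity_projection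
    (φ := ![![1, 0, 0, 0], ![0, 1, 0, 0], ![0, 0, sqrtTwo / 2, sqrtTwo / 2]])
    (fun q r => ⟨q, fun g hg => ?_⟩) (fun _ _ => rfl) (fun s t => ?_) (fun v hv => ?_)
    ⟨![(Real.pi : ℂ) / 2, 0, 0], Or.inl ?_⟩ h0
  · simp only [dotProduct_cons_cons_cons]
    rw [show (0 : Fin 3 → ℂ) = ![0, 0, 0] by ext s; fin_cases s <;> rfl]
    simp [configF4, dotProduct, configF4A1two, Fin.sum_univ_succ]
    ring_nf
  · fin_cases s <;> fin_cases t <;> simp [dotProduct, Fin.sum_univ_succ]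
    linear_combination sqrtTwo_mul_self / 2
  · have h1 := hv 15 fun s => by
      fin_cases s <;> simp [configF4, dotProduct, Fin.sum_univ_succ]
    simp [configF4, dotProduct, Fin.sum_univ_four] at h1
    have h2 := sqrtTwo_mul_self
    ext p
    fin_cases p <;> simp [dotProduct, Fin.sum_univ_four, Fin.sum_univ_three]
    · linear_combination (-(v 2 + v 3) / 4) * h2 + h1 / 2
    · linear_combination (-(v 2 + v 3) / 4) * h2 - h1 / 2
  · ext p
    fin_cases p <;> simp [TrigConfig.embed, Fin.sum_univ_three]

theorem fieldIsIdentity_A2one {q r : ℂ} (h0 : r ≠ 0) :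
    (r = -2 * q → (configF4A2one q r).FieldIsIdentity (configF4A2one q r).mult (-1 / (4 * q)) 0) ∧
    (r = -4 * q →
      (configF4A2one q r).FieldIsIdentity (configF4A2one 0 r).mult (1 / (4 * q)) (36 * q)) := by
  refine fieldIsIdentity_projection
    (φ := ![![1, 0, 0, 0], ![0, 1 / sqrtThree, 1 / sqrtThree, 1 / sqrtThree]])
    (fun q r => ⟨3 * q, fun g hg => ?_⟩) (fun _ _ => rfl) (fun s t => ?_) (fun v hv => ?_)
    ⟨![(Real.pi : ℂ) / 2, 0], Or.inl ?_⟩ h0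
  · simp only [dotProduct_cons_cons]
    rw [show (0 : Fin 2 → ℂ) = ![0, 0] by ext s; fin_cases s <;> rfl]
    simp [configF4, dotProduct, configF4A2one, Fin.sum_univ_succ]
    ring_nf
  · have h3 := sqrtThree_ne_zero
    fin_cases s <;> fin_cases t <;> simp [dotProduct, Fin.sum_univ_succ]
    field_simp
    linear_combination -sqrtThree_mul_self
  · have h1 := hv 11 fun s => by
      fin_cases s <;> simp [configF4, dotProduct, Fin.sum_univ_succ]
    have h2 := hv 15 fun s => by
      fin_cases s <;> simp [configF4, dotProduct, Fin.sum_univ_succ]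
    simp [configF4, dotProduct, Fin.sum_univ_four] at h1 h2
    have h3 := sqrtThree_ne_zero
    ext p
    fin_cases p <;> simp [dotProduct, Fin.sum_univ_four, Fin.sum_univ_two] <;> field_simp
    · linear_combination v 1 * sqrtThree_mul_self + 2 * h1 + h2
    · linear_combination v 2 * sqrtThree_mul_self - h1 + h2
    · linear_combination v 3 * sqrtThree_mul_self - h1 - 2 * h2
  · ext p
    fin_cases p <;> simp [TrigConfig.embed, Fin.sum_univ_two]

theorem fieldIsIdentity_A2two {q r : ℂ} (h0 : r ≠ 0) :
    (r = -2 * q → (configF4A2two q r).FieldIsIdentity (configF4A2two q r).mult (-1 / (4 * q)) 0) ∧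
    (r = -4 * q →
      (configF4A2two q r).FieldIsIdentity (configF4A2two 0 r).mult (1 / (4 * q)) (36 * q)) := by
  refine fieldIsIdentity_projection
    (φ := ![![0, 1 / sqrtTwo, -1 / sqrtTwo, 0], ![2 / sqrtSix, 1 / sqrtSix, 1 / sqrtSix, 0]])
    (fun q r => ⟨3 * r, fun g hg => ?_⟩) (fun _ _ => rfl) (fun s t => ?_) (fun v hv => ?_)
    -- The coordinates are the inner products of `(π/2, π/2, 0, 0)` with the orthonormal basis.
    ⟨![(Real.pi : ℂ) / 2 * (1 / sqrtTwo), (Real.pi : ℂ) / 2 * (3 / sqrtSix)], Or.inr ?_⟩ h0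
  · rw [← configF4A2two_isProjection q r g hg]
    refine Finset.sum_congr rfl fun k _ => congrArg (_ * g ·) ?_
    ext s; fin_cases s <;> rfl
  · have h2 := sqrtTwo_ne_zero
    have h6 := sqrtSix_ne_zero
    fin_cases s <;> fin_cases t <;> simp [dotProduct, Fin.sum_univ_succ] <;> field_simp
    · linear_combination -sqrtTwo_mul_self
    · ring
    · ring
    · linear_combination -sqrtSix_mul_self
  · have h2 := sqrtTwo_ne_zero
    have h6 := sqrtSix_ne_zero
    have h3 := hv 3 fun s => by
      fin_cases s <;> simp [configF4, dotProduct, Fin.sum_univ_succ]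
    have h4 := hv 23 fun s => by
      fin_cases s <;> simp [configF4, dotProduct, Fin.sum_univ_succ] <;> ring
    simp [configF4, dotProduct, Fin.sum_univ_four] at h3 h4
    have e2 : sqrtTwo ^ 2 = 2 := by rw [sq, sqrtTwo_mul_self]
    have e6 : sqrtSix ^ 2 = 6 := by rw [sq, sqrtSix_mul_self]
    ext p
    fin_cases p <;> simp [dotProduct, Fin.sum_univ_four, Fin.sum_univ_two, h3] <;>
      field_simp <;> simp only [e2, e6]
    · linear_combination 4 * h4 + 2 * h3
    · linear_combination -8 * h4 - 4 * h3
    · linear_combination -8 * h4 - 4 * h3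
  · have h2 := sqrtTwo_ne_zero
    have h6 := sqrtSix_ne_zero
    have e2 : sqrtTwo ^ 2 = 2 := by rw [sq, sqrtTwo_mul_self]
    have e6 : sqrtSix ^ 2 = 6 := by rw [sq, sqrtSix_mul_self]
    ext p
    fin_cases p <;> simp [TrigConfig.embed, Fin.sum_univ_two] <;> field_simp <;>
      simp only [e2, e6] <;> norm_num

theorem fieldIsIdentity_B2 {q r : ℂ} (h0 : r ≠ 0) :
    (r = -2 * q → (configF4B2 q r).FieldIsIdentity (configF4B2 q r).mult (-1 / (4 * q)) 0) ∧
    (r = -4 * q →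
      (configF4B2 q r).FieldIsIdentity (configF4B2 0 r).mult (1 / (4 * q)) (36 * q)) := by
  refine fieldIsIdentity_projection (φ := ![![1, 0, 0, 0], ![0, 1, 0, 0]])
    (fun q r => ⟨2 * r + 2 * q, fun g hg => ?_⟩) (fun _ _ => rfl) (fun s t => ?_) (fun v hv => ?_)
    ⟨![(Real.pi : ℂ) / 2, 0], Or.inl ?_⟩ h0
  · rw [← configF4B2_isProjection q r g]
    refine Finset.sum_congr rfl fun k _ => congrArg (_ * g ·) ?_
    ext s; fin_cases s <;> simp [dotProduct, Fin.sum_univ_four]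
  · fin_cases s <;> fin_cases t <;> simp [dotProduct, Fin.sum_univ_succ]
  · have h1 := hv 2 fun s => by
      fin_cases s <;> simp [configF4, dotProduct, Fin.sum_univ_succ]
    have h2 := hv 3 fun s => by
      fin_cases s <;> simp [configF4, dotProduct, Fin.sum_univ_succ]
    simp [configF4, dotProduct, Fin.sum_univ_four] at h1 h2
    ext p
    fin_cases p <;> simp [dotProduct, Fin.sum_univ_four, Fin.sum_univ_two, h1, h2]
  · ext p
    fin_cases p <;> simp [TrigConfig.embed, Fin.sum_univ_two]

theorem fieldIsIdentity_A1sq {q r : ℂ} (h0 : r ≠ 0) :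
    (r = -2 * q → (configF4A1sq q r).FieldIsIdentity (configF4A1sq q r).mult (-1 / (4 * q)) 0) ∧
    (r = -4 * q →
      (configF4A1sq q r).FieldIsIdentity (configF4A1sq 0 r).mult (1 / (4 * q)) (36 * q)) := by
  refine fieldIsIdentity_projection
    (φ := ![![1, 0, 0, 0], ![0, sqrtTwo / 2, sqrtTwo / 2, 0]])
    (fun q r => ⟨r + q, fun g hg => ?_⟩) (fun _ _ => rfl) (fun s t => ?_) (fun v hv => ?_)
    ⟨![(Real.pi : ℂ) / 2, 0], Or.inl ?_⟩ h0
  · simp only [dotProduct_cons_cons]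
    rw [show (0 : Fin 2 → ℂ) = ![0, 0] by ext s; fin_cases s <;> rfl]
    simp [configF4, dotProduct, configF4A1sq, Fin.sum_univ_succ, div_eq_mul_inv _ sqrtTwo, inv_sqrtTwo]
    ring_nf
  · fin_cases s <;> fin_cases t <;> simp [dotProduct, Fin.sum_univ_succ]
    linear_combination sqrtTwo_mul_self / 2
  · have h1 := hv 11 fun s => by
      fin_cases s <;> simp [configF4, dotProduct, Fin.sum_univ_succ]
    have h3 := hv 3 fun s => by
      fin_cases s <;> simp [configF4, dotProduct, Fin.sum_univ_succ]
    simp [configF4, dotProduct, Fin.sum_univ_four] at h1 h3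
    have h2 := sqrtTwo_mul_self
    ext p
    fin_cases p <;> simp [dotProduct, Fin.sum_univ_four, Fin.sum_univ_two, h3]
    · linear_combination (-(v 1 + v 2) / 4) * h2 + h1 / 2
    · linear_combination (-(v 1 + v 2) / 4) * h2 - h1 / 2
  · ext p
    fin_cases p <;> simp [TrigConfig.embed, Fin.sum_univ_two]

end F4

end

/-! ### Cotangent identities and `BC₁`. -/

noncomputable section

open Complex (sin cos)

theorem sin_sq_eq_half_sub (z : ℂ) : sin z ^ 2 = (1 - cos (2 * z)) / 2 := by
  rw [Complex.cos_two_mul, Complex.cos_sq']; ring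

theorem cot_mul_sin_two_mul {z : ℂ} (hz : sin z ≠ 0) :
    Complex.cot z * sin (2 * z) = 1 + cos (2 * z) := by
  rw [Complex.cot_eq_cos_div_sin, Complex.sin_two_mul, Complex.cos_two_mul]
  field_simp
  ring

theorem cot_mul_sin {z : ℂ} (hz : sin z ≠ 0) : Complex.cot z * sin z = cos z := by
  rw [Complex.cot_eq_cos_div_sin, div_mul_cancel₀ _ hz]

/-- Both sums have the factor `2 cos (a - b)`, with cofactors `sin (a + b)` and `cos (a + b)`. -/
theorem cot_add_mul {a b : ℂ} (h : sin (a + b) ≠ 0) :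
    Complex.cot (a + b) * (sin (2 * a) + sin (2 * b)) = cos (2 * a) + cos (2 * b) := by
  rw [F4.sin_two_mul_add_sin_two_mul, F4.cos_two_mul_add_cos_two_mul, ← cot_mul_sin h]
  ring

theorem cot_sub_mul {a b : ℂ} (h : sin (a - b) ≠ 0) :
    Complex.cot (a - b) * (sin (2 * a) - sin (2 * b)) = cos (2 * a) + cos (2 * b) := by
  rw [sub_eq_add_neg] at h
  have := cot_add_mul h
  rwa [mul_neg, Complex.sin_neg, Complex.cos_neg, ← sub_eq_add_neg, ← sub_eq_add_neg] at this

namespace BC1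

theorem fieldIsIdentity {r s : ℂ} (hr : r ≠ 0) (hrs : r + 8 * s ≠ 0) :
    (configBC1 r s).FieldIsIdentity (configBC1 r 0).mult
      (-1 / (2 * (r + 8 * s))) (-(r * (r + 4 * s)) / (r + 8 * s)) := by
  refine TrigConfig.fieldIsIdentity_of_sum_cot _ _ _ _ ?_ fun x hx i j => ?_
  -- Between `0` and `π/2` the function `H` changes by `r`, whatever the constant `H₀`.
  · by_contra! h
    generalize -(r * (r + 4 * s)) / (r + 8 * s) = c at h
    have h0 := h 0
    have h1 := h ![(Real.pi : ℂ) / 2]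
    simp only [TrigConfig.denom, configBC1, Fin.sum_univ_two, dotProduct, Fin.sum_univ_one] at h0 h1
    simp at h0 h1
    refine hr ?_
    linear_combination h1 - h0
  · have h1 := hx 0
    have h2 := hx 1
    have e1 : (configBC1 r s).vec 0 ⬝ᵥ x = x 0 := by simp [configBC1, dotProduct]
    have e2 : (configBC1 r s).vec 1 ⬝ᵥ x = 2 * x 0 := by simp [configBC1, dotProduct]
    have e3 : (configBC1 r s).numField (configBC1 r 0).mult x 0 = r * sin (2 * x 0) := by
      simp only [TrigConfig.numField, Fin.sum_univ_two, e1, e2]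
      simp [configBC1]
    have e4 : (configBC1 r s).vec 0 ⬝ᵥ (configBC1 r s).numField (configBC1 r 0).mult x =
        r * sin (2 * x 0) := by
      rw [← e3]; simp [configBC1, dotProduct]
    have e5 : (configBC1 r s).vec 1 ⬝ᵥ (configBC1 r s).numField (configBC1 r 0).mult x =
        2 * (r * sin (2 * x 0)) := by
      rw [← e3]; simp [configBC1, dotProduct]
    have e6 : (configBC1 r s).denom (configBC1 r 0).mult (-(r * (r + 4 * s)) / (r + 8 * s)) x =
        -(r * (r + 4 * s)) / (r + 8 * s) + r * ((1 - cos (2 * x 0)) / 2) := by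
      simp only [TrigConfig.denom, Fin.sum_univ_two, e1, e2, sin_sq_eq_half_sub]
      simp [configBC1]
    rw [e1] at h1
    rw [e2] at h2
    have h3 := cot_mul_sin_two_mul h1
    have h4 := cot_mul_sin h2
    rw [if_pos (Subsingleton.elim i j), e6, Fin.sum_univ_two, e4, e5, e1, e2]
    have h5 : (configBC1 r s).mult 0 * (configBC1 r s).vec 0 i * (configBC1 r s).vec 0 j *
        (Complex.cot (x 0) * (r * sin (2 * x 0))) +
        (configBC1 r s).mult 1 * (configBC1 r s).vec 1 i * (configBC1 r s).vec 1 j *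
        (Complex.cot (2 * x 0) * (2 * (r * sin (2 * x 0)))) =
        r * r * (1 + cos (2 * x 0)) + 8 * s * r * cos (2 * x 0) := by
      simp only [Subsingleton.elim i 0, Subsingleton.elim j 0]
      simp only [configBC1, Matrix.cons_val_zero, Matrix.cons_val_one]
      linear_combination r * r * h3 + 8 * s * r * h4
    rw [h5]
    field_simp
    ring

end BC1

/-! ### The root system `G₂`. -/

namespace G2

/-- The trigonometric polynomials `cot (α, x) (α, V x)`, with `a = √3 x₁ / 2` and `b = x₂ / 2`. -/
def cotPoly (l p : ℂ) (k : Fin 6) (x : Fin 2 → ℂ) : ℂ :=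
  let a := sqrtThree * x 0 / 2
  let b := x 1 / 2
  ![3 * l * (1 + cos (4 * a)) + 3 * l / 2 * (cos (2 * a + 6 * b) + cos (2 * a - 6 * b)) +
      3 * p / 2 * (cos (2 * a + 2 * b) + cos (2 * a - 2 * b)),
    3 * l * (1 + cos (2 * a + 6 * b)) + 3 * l / 2 * (cos (4 * a) + cos (2 * a - 6 * b)) +
      3 * p / 2 * (cos (2 * a + 2 * b) + cos (4 * b)),
    3 * l * (1 + cos (2 * a - 6 * b)) + 3 * l / 2 * (cos (4 * a) + cos (2 * a + 6 * b)) +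
      3 * p / 2 * (cos (2 * a - 2 * b) + cos (4 * b)),
    3 * l / 2 * (cos (2 * a + 6 * b) + cos (2 * a - 6 * b)) + p * (1 + cos (4 * b)) +
      (3 * l + p / 2) * (cos (2 * a + 2 * b) + cos (2 * a - 2 * b)),
    3 * l / 2 * (cos (4 * a) + cos (2 * a + 6 * b)) + p * (1 + cos (2 * a + 2 * b)) +
      (3 * l + p / 2) * (cos (2 * a - 2 * b) + cos (4 * b)),
    3 * l / 2 * (cos (4 * a) + cos (2 * a - 6 * b)) + p * (1 + cos (2 * a - 2 * b)) +
      (3 * l + p / 2) * (cos (2 * a + 2 * b) + cos (4 * b))] k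

theorem vec_dotProduct (q p : ℂ) (k : Fin 6) (x : Fin 2 → ℂ) :
    (configG2 q p).vec k ⬝ᵥ x =
      ![2 * (sqrtThree * x 0 / 2), sqrtThree * x 0 / 2 + 3 * (x 1 / 2),
        sqrtThree * x 0 / 2 - 3 * (x 1 / 2), 2 * (x 1 / 2), sqrtThree * x 0 / 2 + x 1 / 2,
        sqrtThree * x 0 / 2 - x 1 / 2] k := by
  fin_cases k <;> simp [configG2, dotProduct, Fin.sum_univ_two] <;> ring

/-- The functions `(α, V x)`. -/
def numPoly (l p a b : ℂ) (k : Fin 6) : ℂ :=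
  ![3 * l * sin (4 * a) + 3 * l / 2 * (sin (2 * a + 6 * b) + sin (2 * a - 6 * b)) +
      3 * p / 2 * (sin (2 * a + 2 * b) + sin (2 * a - 2 * b)),
    3 * l * sin (2 * a + 6 * b) + 3 * l / 2 * (sin (4 * a) - sin (2 * a - 6 * b)) +
      3 * p / 2 * (sin (2 * a + 2 * b) + sin (4 * b)),
    3 * l * sin (2 * a - 6 * b) + 3 * l / 2 * (sin (4 * a) - sin (2 * a + 6 * b)) +
      3 * p / 2 * (sin (2 * a - 2 * b) - sin (4 * b)),
    3 * l / 2 * (sin (2 * a + 6 * b) - sin (2 * a - 6 * b)) + p * sin (4 * b) +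
      p / 2 * (sin (2 * a + 2 * b) - sin (2 * a - 2 * b)),
    3 * l / 2 * (sin (4 * a) + sin (2 * a + 6 * b)) + p * sin (2 * a + 2 * b) +
      p / 2 * (sin (2 * a - 2 * b) + sin (4 * b)),
    3 * l / 2 * (sin (4 * a) + sin (2 * a - 6 * b)) + p * sin (2 * a - 2 * b) +
      p / 2 * (sin (2 * a + 2 * b) - sin (4 * b))] k

theorem vec_dotProduct_numField (q l p : ℂ) (k : Fin 6) (x : Fin 2 → ℂ) :
    (configG2 q p).vec k ⬝ᵥ (configG2 q p).numField (configG2 l p).mult x =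
      numPoly l p (sqrtThree * x 0 / 2) (x 1 / 2) k := by
  rw [numPoly]
  simp only [TrigConfig.numField, vec_dotProduct, Finset.sum_apply, Pi.smul_apply, smul_eq_mul]
  generalize sqrtThree * x 0 / 2 = a
  generalize x 1 / 2 = b
  have h1 : 2 * (2 * a) = 4 * a := by ring
  have h2 : 2 * (a + 3 * b) = 2 * a + 6 * b := by ring
  have h3 : 2 * (a - 3 * b) = 2 * a - 6 * b := by ring
  have h4 : 2 * (2 * b) = 4 * b := by ring
  have h5 : 2 * (a + b) = 2 * a + 2 * b := by ring
  have h6 : 2 * (a - b) = 2 * a - 2 * b := by ring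
  have h := sqrtThree_mul_self
  simp only [configG2, Fin.sum_univ_six, Matrix.cons_val, h1, h2, h3, h4, h5, h6]
  generalize sin (4 * a) = s1
  generalize sin (2 * a + 6 * b) = s2
  generalize sin (2 * a - 6 * b) = s3
  generalize sin (2 * a + 2 * b) = s5
  generalize sin (2 * a - 2 * b) = s6
  generalize sin (4 * b) = s4
  -- The first coordinate of `V` is `√3` times this combination, and pairing with a root brings the
  -- second factor `√3`.
  have h' : (l * s1 + l / 2 * (s2 + s3) + p / 2 * (s5 + s6)) * (sqrtThree * sqrtThree) =
      (l * s1 + l / 2 * (s2 + s3) + p / 2 * (s5 + s6)) * 3 := by rw [h]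
  fin_cases k <;> simp
  · linear_combination h'
  · linear_combination h' / 2
  · linear_combination h' / 2
  · ring
  · linear_combination h' / 2
  · linear_combination h' / 2

/-- The cancellation of `sin u` for a long root. -/
theorem sin_mul_long (l p u v : ℂ) :
    sin u * (3 * l * (1 + cos (2 * u)) + 3 * l / 2 * (cos (u + 3 * v) + cos (u - 3 * v)) +
      3 * p / 2 * (cos (u + v) + cos (u - v))) =
    cos u * (3 * l * sin (2 * u) + 3 * l / 2 * (sin (u + 3 * v) + sin (u - 3 * v)) +
      3 * p / 2 * (sin (u + v) + sin (u - v))) := by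
  simp only [Complex.cos_add, Complex.cos_sub, Complex.sin_add, Complex.sin_sub,
    Complex.sin_two_mul, Complex.cos_two_mul]
  ring

/-- The cancellation of `sin v` for a short root. -/
theorem sin_mul_short (l p u v : ℂ) :
    sin v * (3 * l / 2 * (cos (u + 3 * v) + cos (u - 3 * v)) + p * (1 + cos (2 * v)) +
      (3 * l + p / 2) * (cos (u + v) + cos (u - v))) =
    cos v * (3 * l / 2 * (sin (u + 3 * v) - sin (u - 3 * v)) + p * sin (2 * v) +
      p / 2 * (sin (u + v) - sin (u - v))) := by
  -- The additional `3 * l` comes from `cot v sin 3v = cos 3v + 2 cos v`.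
  simp only [Complex.cos_add, Complex.cos_sub, Complex.sin_add, Complex.sin_sub,
    Complex.sin_two_mul, Complex.cos_two_mul, Complex.sin_three_mul, Complex.cos_three_mul]
  linear_combination (12 * l * cos u * cos v * sin v) * Complex.sin_sq_add_cos_sq v

/-- The positive roots split into three orthogonal pairs of a long and a short root. In the
coordinates `u`, `v` of such a pair the others are `(u ± 3v)/2` and `(u ± v)/2` up to sign, so one
computation per length suffices. -/
theorem sin_mul_cotPoly (q l p : ℂ) (k : Fin 6) (x : Fin 2 → ℂ) :
    sin ((configG2 q p).vec k ⬝ᵥ x) * cotPoly l p k x = cos ((configG2 q p).vec k ⬝ᵥ x) *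
      ((configG2 q p).vec k ⬝ᵥ (configG2 q p).numField (configG2 l p).mult x) := by
  rw [vec_dotProduct_numField, vec_dotProduct, cotPoly, numPoly]
  generalize sqrtThree * x 0 / 2 = a
  generalize x 1 / 2 = b
  fin_cases k <;> simp only [Fin.reduceFinMk, Matrix.cons_val, Fin.zero_eta, Fin.mk_one]
  · have h := sin_mul_long l p (2 * a) (2 * b)
    rw [show 2 * (2 * a) = 4 * a by ring, show 3 * (2 * b) = 6 * b by ring] at h
    linear_combination h
  · have h := sin_mul_long l p (a + 3 * b) (a - b)
    rw [show 2 * (a + 3 * b) = 2 * a + 6 * b by ring,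
      show a + 3 * b + 3 * (a - b) = 4 * a by ring,
      show a + 3 * b - 3 * (a - b) = -(2 * a - 6 * b) by ring,
      show a + 3 * b + (a - b) = 2 * a + 2 * b by ring,
      show a + 3 * b - (a - b) = 4 * b by ring, Complex.sin_neg, Complex.cos_neg] at h
    linear_combination h
  · have h := sin_mul_long l p (a - 3 * b) (a + b)
    rw [show 2 * (a - 3 * b) = 2 * a - 6 * b by ring,
      show a - 3 * b + 3 * (a + b) = 4 * a by ring,
      show a - 3 * b - 3 * (a + b) = -(2 * a + 6 * b) by ring,
      show a - 3 * b + (a + b) = 2 * a - 2 * b by ring,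
      show a - 3 * b - (a + b) = -(4 * b) by ring, Complex.sin_neg, Complex.cos_neg,
      Complex.sin_neg, Complex.cos_neg] at h
    linear_combination h
  · have h := sin_mul_short l p (2 * a) (2 * b)
    rw [show 2 * (2 * b) = 4 * b by ring, show 3 * (2 * b) = 6 * b by ring] at h
    linear_combination h
  · have h := sin_mul_short l p (a - 3 * b) (a + b)
    rw [show 2 * (a + b) = 2 * a + 2 * b by ring,
      show a - 3 * b + 3 * (a + b) = 4 * a by ring,
      show a - 3 * b - 3 * (a + b) = -(2 * a + 6 * b) by ring,
      show a - 3 * b + (a + b) = 2 * a - 2 * b by ring,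
      show a - 3 * b - (a + b) = -(4 * b) by ring, Complex.sin_neg, Complex.cos_neg,
      Complex.sin_neg, Complex.cos_neg] at h
    linear_combination h
  · have h := sin_mul_short l p (a + 3 * b) (a - b)
    rw [show 2 * (a - b) = 2 * a - 2 * b by ring,
      show a + 3 * b + 3 * (a - b) = 4 * a by ring,
      show a + 3 * b - 3 * (a - b) = -(2 * a - 6 * b) by ring,
      show a + 3 * b + (a - b) = 2 * a + 2 * b by ring,
      show a + 3 * b - (a - b) = 4 * b by ring, Complex.sin_neg, Complex.cos_neg] at h
    linear_combination h

theorem denom_eq (q l p H₀ : ℂ) (x : Fin 2 → ℂ) :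
    (configG2 q p).denom (configG2 l p).mult H₀ x = H₀ + 3 * (l + p) / 2 -
      l / 2 * (cos (4 * (sqrtThree * x 0 / 2)) +
        cos (2 * (sqrtThree * x 0 / 2) + 6 * (x 1 / 2)) +
        cos (2 * (sqrtThree * x 0 / 2) - 6 * (x 1 / 2))) -
      p / 2 * (cos (4 * (x 1 / 2)) + cos (2 * (sqrtThree * x 0 / 2) + 2 * (x 1 / 2)) +
        cos (2 * (sqrtThree * x 0 / 2) - 2 * (x 1 / 2))) := by
  simp only [TrigConfig.denom, vec_dotProduct, sin_sq_eq_half_sub]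
  generalize sqrtThree * x 0 / 2 = a
  generalize x 1 / 2 = b
  have h1 : 2 * (2 * a) = 4 * a := by ring
  have h2 : 2 * (a + 3 * b) = 2 * a + 6 * b := by ring
  have h3 : 2 * (a - 3 * b) = 2 * a - 6 * b := by ring
  have h4 : 2 * (2 * b) = 4 * b := by ring
  have h5 : 2 * (a + b) = 2 * a + 2 * b := by ring
  have h6 : 2 * (a - b) = 2 * a - 2 * b := by ring
  simp only [configG2, Fin.sum_univ_six, Matrix.cons_val, h1, h2, h3, h4, h5, h6]
  ring

theorem sum_mult (q p : ℂ) (T : Fin 6 → ℂ) (i j : Fin 2) :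
    ∑ k, (configG2 q p).mult k * (configG2 q p).vec k i * (configG2 q p).vec k j * T k =
      ![![3 * (q * T 0 + q / 4 * (T 1 + T 2) + p / 4 * (T 4 + T 5)),
          sqrtThree / 4 * (3 * q * (T 1 - T 2) + p * (T 4 - T 5))],
        ![sqrtThree / 4 * (3 * q * (T 1 - T 2) + p * (T 4 - T 5)),
          9 * q / 4 * (T 1 + T 2) + p * (T 3 + (T 4 + T 5) / 4)]] i j := by
  have h := sqrtThree_mul_self
  fin_cases i <;> fin_cases j <;> simp [configG2, Fin.sum_univ_six]
  · linear_combination (q * T 0 + q / 4 * (T 1 + T 2) + p / 4 * (T 4 + T 5)) * h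
  all_goals ring

/-- `H` has equal coefficients at `cos 4b` and `cos (2a + 2b)`. Comparing these in entry `(1, 1)`
gives, for `p ≠ 0`, `p = 6l - 9q`, where `l` is the value of `c̄` on long roots; `l = q` and `l = 0`
are the two cases. -/
theorem isCotContinuation_of_eq_neg_three_mul {q p : ℂ} (hp : p = -3 * q) (hq : q ≠ 0) :
    (configG2 q p).IsCotContinuation (configG2 q p).mult (-1 / (9 * q)) 0 (cotPoly q p) := by
  refine ⟨sin_mul_cotPoly q q p, fun x i j => ?_⟩
  have h1 : (if i = j then (configG2 q p).denom (configG2 q p).mult 0 x else 0) =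
      -1 / (9 * q) * (-9 * q *
        if i = j then (configG2 q p).denom (configG2 q p).mult 0 x else 0) := by
    field_simp
  rw [h1, sum_mult, denom_eq, hp]
  congr 1
  fin_cases i <;> fin_cases j <;> simp [-mul_eq_zero, cotPoly] <;> ring

theorem isCotContinuation_of_eq_neg_nine_mul {q p : ℂ} (hp : p = -9 * q) (hq : q ≠ 0) :
    (configG2 q p).IsCotContinuation (configG2 0 p).mult (1 / (9 * q)) (27 * q) (cotPoly 0 p) := by
  refine ⟨sin_mul_cotPoly q 0 p, fun x i j => ?_⟩
  have h1 : (if i = j then (configG2 q p).denom (configG2 0 p).mult (27 * q) x else 0) =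
      1 / (9 * q) * (9 * q *
        if i = j then (configG2 q p).denom (configG2 0 p).mult (27 * q) x else 0) := by
    field_simp
  rw [h1, sum_mult, denom_eq, hp]
  congr 1
  fin_cases i <;> fin_cases j <;> simp [-mul_eq_zero, cotPoly] <;> ring

theorem fieldIsIdentity {q p : ℂ} (h0 : p ≠ 0) :
    (p = -3 * q → (configG2 q p).FieldIsIdentity (configG2 q p).mult (-1 / (9 * q)) 0) ∧
    (p = -9 * q →
      (configG2 q p).FieldIsIdentity (configG2 0 p).mult (1 / (9 * q)) (27 * q)) := by
  refine ⟨fun hp => ?_, fun hp => ?_⟩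
  · have hq : q ≠ 0 := by rintro rfl; simp [hp] at h0
    -- `H` vanishes at the origin; at this point it is `-4q`.
    refine (isCotContinuation_of_eq_neg_three_mul hp hq).fieldIsIdentity ⟨![0, Real.pi], ?_⟩
    have h1 : (6 : ℂ) * (Real.pi / 2) = Real.pi + 2 * Real.pi := by ring
    have h2 : (4 : ℂ) * (Real.pi / 2) = 2 * Real.pi := by ring
    have h3 : (2 : ℂ) * (Real.pi / 2) = Real.pi := by ring
    have h4 : (configG2 q p).denom (configG2 q p).mult 0 ![0, Real.pi] = -4 * q := by
      rw [denom_eq, hp]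
      simp [h1, h2, h3, Complex.cos_add]
      ring
    rw [h4]
    exact mul_ne_zero (by norm_num) hq
  · have hq : q ≠ 0 := by rintro rfl; simp [hp] at h0
    exact (isCotContinuation_of_eq_neg_nine_mul hp hq).fieldIsIdentity
      ⟨0, by simpa [TrigConfig.denom] using hq⟩

end G2

end

/-! ### The family `BC_n`. -/

noncomputable section

open Complex (sin cos)

namespace BC

theorem sum_lt_pairs {n : ℕ} (F : Fin n → Fin n → ℂ) :
    ∑ p : {p : Fin n × Fin n // p.1 < p.2}, F p.1.1 p.1.2 =
      ∑ a, ∑ b, if a < b then F a b else 0 := by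
  rw [← Fintype.sum_prod_type' (f := fun a b => if a < b then F a b else 0), ← Finset.sum_filter]
  exact (Finset.sum_subtype _ (fun p => by simp) fun p : Fin n × Fin n => F p.1 p.2).symm

/-- The sum over the pairs that contain `i`. -/
theorem sum_pairs_containing {n : ℕ} (g : Fin n → ℂ) (i : Fin n) :
    ∑ p : {p : Fin n × Fin n // p.1 < p.2},
      ((if i = p.1.1 then g p.1.2 else 0) + if i = p.1.2 then g p.1.1 else 0) =
      ∑ l, g l - g i := by
  rw [sum_lt_pairs fun a b => (if i = a then g b else 0) + if i = b then g a else 0]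
  have h1 : ∀ a b : Fin n,
      (if a < b then (if i = a then g b else 0) + (if i = b then g a else 0) else 0) =
      (if i = a then (if i < b then g b else 0) else 0) +
        if i = b then (if a < i then g a else 0) else 0 := by
    intro a b
    by_cases ha : i = a <;> by_cases hb : i = b
    · simp [← ha, ← hb]
    · simp [← ha, hb]
    · simp [ha, ← hb]
    · simp [ha, hb]
  simp only [h1, Finset.sum_add_distrib, Finset.sum_ite_eq, Finset.mem_univ, if_true]
  rw [Finset.sum_comm]
  simp only [Finset.sum_ite_eq, Finset.mem_univ, if_true]
  rw [← Finset.sum_add_distrib, eq_sub_iff_add_eq]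
  have h2 : g i = ∑ l, if i = l then g l else 0 := by simp
  rw [h2, ← Finset.sum_add_distrib]
  refine Finset.sum_congr rfl fun l _ => ?_
  rcases lt_trichotomy i l with h | h | h
  · simp [h, h.ne, h.not_gt]
  · simp [h]
  · simp [h, h.ne', h.not_gt]

variable {n : ℕ} (q r s : ℂ) (m w x : Fin n → ℂ)

/-- At `q = s = 0` only the vectors along `e_i` keep a coefficient, so each component of `V` depends
on one coordinate. -/
theorem numField_eq : (configBC n q r s m w).numField (configBC n 0 r 0 m w).mult x =
    fun i => r * m i * w i * sin (2 * (w i * x i)) := by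
  funext i
  simp only [TrigConfig.numField, Fintype.sum_sum_type, Finset.sum_apply, Pi.smul_apply,
    smul_eq_mul]
  simp only [configBC, zero_mul, mul_zero, Finset.sum_const_zero, add_zero, single_dotProduct,
    Pi.single_apply, mul_ite, Finset.sum_ite_eq, Finset.mem_univ, if_true]
  ring

theorem denom_eq (H₀ : ℂ) : (configBC n q r s m w).denom (configBC n 0 r 0 m w).mult H₀ x =
    H₀ + ∑ i, r * m i * sin (w i * x i) ^ 2 := by
  simp only [TrigConfig.denom, Fintype.sum_sum_type]
  simp only [configBC, zero_mul, mul_zero, Finset.sum_const_zero, add_zero, single_dotProduct]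

variable {m w x}

/-- Off the diagonal the two signs of a pair cancel. On it the pairs give a sum over `l ≠ i`, and
the `m i ^ 2` part of the multiplicity of the doubled vector supplies exactly the missing term `l =
i`. -/
theorem sum_cot (hw : ∀ i, w i ^ 2 * m i = 1)
    (hx : ∀ k, sin ((configBC n q r s m w).vec k ⬝ᵥ x) ≠ 0) (i j : Fin n) :
    ∑ k, (configBC n q r s m w).mult k * (configBC n q r s m w).vec k i *
      (configBC n q r s m w).vec k j * (Complex.cot ((configBC n q r s m w).vec k ⬝ᵥ x) *
        ((configBC n q r s m w).vec k ⬝ᵥ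
          (configBC n q r s m w).numField (configBC n 0 r 0 m w).mult x)) =
    if i = j then r * (r + (r + 8 * s - 4 * q + 2 * q * ∑ l, m l) * cos (2 * (w i * x i)) +
      2 * q * ∑ l, m l * cos (2 * (w l * x l))) else 0 := by
  have hx1 (l : Fin n) : sin (w l * x l) ≠ 0 := by
    simpa [configBC] using hx (.inl l)
  have hx2 (l : Fin n) : sin (2 * (w l * x l)) ≠ 0 := by
    simpa [configBC, mul_assoc] using hx (.inr (.inl l))
  have hx3 (p : {p : Fin n × Fin n // p.1 < p.2}) :
      sin (w p.1.1 * x p.1.1 + w p.1.2 * x p.1.2) ≠ 0 := by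
    simpa [configBC] using hx (.inr (.inr (p, true)))
  have hx4 (p : {p : Fin n × Fin n // p.1 < p.2}) :
      sin (w p.1.1 * x p.1.1 - w p.1.2 * x p.1.2) ≠ 0 := by
    simpa [configBC] using hx (.inr (.inr (p, false)))
  set C : Fin n → ℂ := fun l => cos (2 * (w l * x l)) with hC
  have hV (l : Fin n) : w l * (r * m l * w l * sin (2 * (w l * x l))) =
      r * sin (2 * (w l * x l)) := by
    linear_combination r * sin (2 * (w l * x l)) * hw l
  have e1 (l : Fin n) : Complex.cot (w l * x l) * (r * sin (2 * (w l * x l))) = r * (1 + C l) := by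
    rw [hC]
    linear_combination r * cot_mul_sin_two_mul (hx1 l)
  have e2 (l : Fin n) : Complex.cot (2 * (w l * x l)) * (2 * (r * sin (2 * (w l * x l)))) =
      2 * r * C l := by
    rw [hC]
    linear_combination 2 * r * cot_mul_sin (hx2 l)
  have e3 (p : {p : Fin n × Fin n // p.1 < p.2}) :
      Complex.cot (w p.1.1 * x p.1.1 + w p.1.2 * x p.1.2) *
        (r * sin (2 * (w p.1.1 * x p.1.1)) + r * sin (2 * (w p.1.2 * x p.1.2))) =
      r * (C p.1.1 + C p.1.2) := by
    rw [hC]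
    linear_combination r * cot_add_mul (hx3 p)
  have e4 (p : {p : Fin n × Fin n // p.1 < p.2}) :
      Complex.cot (w p.1.1 * x p.1.1 - w p.1.2 * x p.1.2) *
        (r * sin (2 * (w p.1.1 * x p.1.1)) - r * sin (2 * (w p.1.2 * x p.1.2))) =
      r * (C p.1.1 + C p.1.2) := by
    rw [hC]
    linear_combination r * cot_sub_mul (hx4 p)
  simp only [Fintype.sum_sum_type, Fintype.sum_prod_type, numField_eq, Fintype.sum_bool]
  simp only [configBC, single_dotProduct, add_dotProduct, sub_dotProduct, mul_assoc 2 (w _), hV,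
    e1, e2, e3, e4, Pi.add_apply, Pi.sub_apply]
  have hs (l : Fin n) (a b : ℂ) : (Pi.single l a : Fin n → ℂ) i * (Pi.single l b : Fin n → ℂ) j =
      if i = j then (if i = l then a * b else 0) else 0 := by
    simp only [Pi.single_apply]
    split_ifs <;> simp_all
  have f1 : ∑ l, r * m l * (Pi.single l (w l) : Fin n → ℂ) i * (Pi.single l (w l) : Fin n → ℂ) j *
      (r * (1 + C l)) = if i = j then r * (r * (1 + C i)) else 0 := by
    simp only [mul_assoc _ ((Pi.single _ _ : Fin n → ℂ) i), hs]
    split_ifs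
    · simp only [mul_ite, ite_mul, mul_zero, zero_mul, Finset.sum_ite_eq, Finset.mem_univ, if_true]
      linear_combination r * (r * (1 + C i)) * hw i
    · simp
  have f2 : ∑ l, (s * m l + 1 / 2 * q * m l * (m l - 1)) *
      (Pi.single l (2 * w l) : Fin n → ℂ) i * (Pi.single l (2 * w l) : Fin n → ℂ) j *
      (2 * r * C l) = if i = j then (8 * s + 4 * q * (m i - 1)) * r * C i else 0 := by
    simp only [mul_assoc _ ((Pi.single _ _ : Fin n → ℂ) i), hs]
    split_ifs
    · simp only [mul_ite, ite_mul, mul_zero, zero_mul, Finset.sum_ite_eq, Finset.mem_univ, if_true]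
      linear_combination (8 * s + 4 * q * (m i - 1)) * r * C i * hw i
    · simp
  have f3 (p : {p : Fin n × Fin n // p.1 < p.2}) :
      q * m p.1.1 * m p.1.2 *
        ((Pi.single p.1.1 (w p.1.1) : Fin n → ℂ) i + (Pi.single p.1.2 (w p.1.2) : Fin n → ℂ) i) *
        ((Pi.single p.1.1 (w p.1.1) : Fin n → ℂ) j + (Pi.single p.1.2 (w p.1.2) : Fin n → ℂ) j) *
        (r * (C p.1.1 + C p.1.2)) +
      q * m p.1.1 * m p.1.2 *
        ((Pi.single p.1.1 (w p.1.1) : Fin n → ℂ) i - (Pi.single p.1.2 (w p.1.2) : Fin n → ℂ) i) *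
        ((Pi.single p.1.1 (w p.1.1) : Fin n → ℂ) j - (Pi.single p.1.2 (w p.1.2) : Fin n → ℂ) j) *
        (r * (C p.1.1 + C p.1.2)) =
      if i = j then 2 * q * r * ((if i = p.1.1 then m p.1.2 * (C i + C p.1.2) else 0) +
        if i = p.1.2 then m p.1.1 * (C i + C p.1.1) else 0) else 0 := by
    have h1 := hs p.1.1 (w p.1.1) (w p.1.1)
    have h2 := hs p.1.2 (w p.1.2) (w p.1.2)
    -- Both signs carry the same factor `C p.1.1 + C p.1.2`, so the mixed products of the two
    -- coordinates drop out and the squares double.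
    trans 2 * q * r * (m p.1.1 * m p.1.2 * (C p.1.1 + C p.1.2)) *
      ((if i = j then (if i = p.1.1 then w p.1.1 * w p.1.1 else 0) else 0) +
        if i = j then (if i = p.1.2 then w p.1.2 * w p.1.2 else 0) else 0)
    · rw [← h1, ← h2]
      ring
    · rcases eq_or_ne i j with hij | hij
      · simp only [if_pos hij]
        have hne := p.2.ne
        by_cases hi : i = p.1.1
        · rw [if_pos hi, if_pos hi, if_neg (hi ▸ hne), if_neg (hi ▸ hne), hi]
          linear_combination 2 * q * r * m p.1.2 * (C p.1.1 + C p.1.2) * hw p.1.1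
        · rw [if_neg hi, if_neg hi]
          by_cases hi' : i = p.1.2
          · rw [if_pos hi', if_pos hi', hi']
            linear_combination 2 * q * r * m p.1.1 * (C p.1.1 + C p.1.2) * hw p.1.2
          · simp [hi']
      · simp [hij]
  rw [f1, f2, Finset.sum_congr rfl fun p _ => f3 p]
  split_ifs with hij
  · rw [← Finset.mul_sum, sum_pairs_containing fun l => m l * (C i + C l)]
    have f4 : ∑ l, m l * (C i + C l) = (∑ l, m l) * C i + ∑ l, m l * C l := by
      rw [Finset.sum_mul, ← Finset.sum_add_distrib]
      exact Finset.sum_congr rfl fun l _ => by ring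
    rw [f4]
    ring
  · simp

theorem fieldIsIdentity {q r s : ℂ} (hn : 2 ≤ n) (hq : q ≠ 0) (hr : r ≠ 0)
    (hm : ∀ i, m i ≠ 0) (hw : ∀ i, w i ^ 2 = (m i)⁻¹)
    (h : r = -8 * s - 2 * q * ((∑ i, m i) - 2)) :
    (configBC n q r s m w).FieldIsIdentity (configBC n 0 r 0 m w).mult
      (-1 / (4 * q)) (r * (2 * s - q) / q) := by
  have hw' (i : Fin n) : w i ^ 2 * m i = 1 := by rw [hw, inv_mul_cancel₀ (hm i)]
  refine TrigConfig.fieldIsIdentity_of_sum_cot _ _ _ _ ?_ fun x hx i j => ?_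
  -- Moving one coordinate so that `w i₀ * x i₀` goes from `0` to `π/2` changes `H` by `r * m i₀ ≠
  -- 0`.
  · by_contra! hH
    have i₀ : Fin n := ⟨0, by omega⟩
    have hw0 : w i₀ ≠ 0 := by
      intro h0; have := hw' i₀; rw [h0] at this; simp at this
    have h0 := hH 0
    have h1 := hH (Pi.single i₀ ((Real.pi : ℂ) / 2 / w i₀))
    rw [denom_eq] at h0 h1
    rw [Finset.sum_eq_single i₀ (fun l _ hl => by simp [hl]) (by simp)] at h1
    rw [Pi.single_eq_same, mul_div_cancel₀ _ hw0, Complex.sin_pi_div_two] at h1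
    simp only [Pi.zero_apply, mul_zero, Complex.sin_zero, ne_eq, OfNat.ofNat_ne_zero,
      not_false_eq_true, zero_pow, Finset.sum_const_zero] at h0
    exact mul_ne_zero hr (hm i₀) (by linear_combination h1 - h0)
  · rw [sum_cot q r s hw' hx, denom_eq]
    split_ifs
    · simp only [sin_sq_eq_half_sub]
      have e : ∑ l, r * m l * ((1 - cos (2 * (w l * x l))) / 2) =
          r / 2 * ∑ l, m l - r / 2 * ∑ l, m l * cos (2 * (w l * x l)) := by
        rw [Finset.mul_sum, Finset.mul_sum, ← Finset.sum_sub_distrib]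
        exact Finset.sum_congr rfl fun l _ => by ring
      rw [e]
      -- This is the coefficient of `cos (2 * (w i * x i))`, the only part of a diagonal entry that
      -- depends on `i`. With it gone the matrix is scalar, and its constant term determines `H₀`.
      have h2 : r + 8 * s - 4 * q + 2 * q * ∑ l, m l = 0 := by rw [h]; ring
      rw [h2]
      field_simp
      linear_combination (-2 : ℂ) * h2
    · exact mul_zero _

end BC

end

theorem mainTheorem6 :
    -- `F₄⁺` and its projections, `r = -2q`
    (∀ q r : ℂ, r = -2 * q → r ≠ 0 →
      (configF4 q r).FieldIsIdentity (configF4 q r).mult (-1 / (4 * q)) 0 ∧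
      (configF4A1one q r).FieldIsIdentity (configF4A1one q r).mult (-1 / (4 * q)) 0 ∧
      (configF4A1two q r).FieldIsIdentity (configF4A1two q r).mult (-1 / (4 * q)) 0 ∧
      (configF4A2one q r).FieldIsIdentity (configF4A2one q r).mult (-1 / (4 * q)) 0 ∧
      (configF4A2two q r).FieldIsIdentity (configF4A2two q r).mult (-1 / (4 * q)) 0 ∧
      (configF4B2 q r).FieldIsIdentity (configF4B2 q r).mult (-1 / (4 * q)) 0 ∧
      (configF4A1sq q r).FieldIsIdentity (configF4A1sq q r).mult (-1 / (4 * q)) 0) ∧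
    -- `F₄⁺` and its projections, `r = -4q`
    (∀ q r : ℂ, r = -4 * q → r ≠ 0 →
      (configF4 q r).FieldIsIdentity (configF4 0 r).mult (1 / (4 * q)) (36 * q) ∧
      (configF4A1one q r).FieldIsIdentity (configF4A1one 0 r).mult (1 / (4 * q)) (36 * q) ∧
      (configF4A1two q r).FieldIsIdentity (configF4A1two 0 r).mult (1 / (4 * q)) (36 * q) ∧
      (configF4A2one q r).FieldIsIdentity (configF4A2one 0 r).mult (1 / (4 * q)) (36 * q) ∧
      (configF4A2two q r).FieldIsIdentity (configF4A2two 0 r).mult (1 / (4 * q)) (36 * q) ∧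
      (configF4B2 q r).FieldIsIdentity (configF4B2 0 r).mult (1 / (4 * q)) (36 * q) ∧
      (configF4A1sq q r).FieldIsIdentity (configF4A1sq 0 r).mult (1 / (4 * q)) (36 * q)) ∧
    -- `G₂⁺`, `p = -3q`
    (∀ q p : ℂ, p = -3 * q → p ≠ 0 →
      (configG2 q p).FieldIsIdentity (configG2 q p).mult (-1 / (9 * q)) 0) ∧
    -- `G₂⁺`, `p = -9q`
    (∀ q p : ℂ, p = -9 * q → p ≠ 0 →
      (configG2 q p).FieldIsIdentity (configG2 0 p).mult (1 / (9 * q)) (27 * q)) ∧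
    -- `BC_n(q, r, s; m)`, `n ≥ 2`
    (∀ (n : ℕ) (q r s : ℂ) (m w : Fin n → ℂ), 2 ≤ n → q ≠ 0 → r ≠ 0 →
      (∀ i, m i ≠ 0) → (∀ i, w i ^ 2 = (m i)⁻¹) →
      r = -8 * s - 2 * q * ((∑ i, m i) - 2) →
      (configBC n q r s m w).FieldIsIdentity (configBC n 0 r 0 m w).mult
        (-1 / (4 * q)) (r * (2 * s - q) / q)) ∧
    -- `BC₁⁺`
    (∀ r s : ℂ, r ≠ 0 → r + 8 * s ≠ 0 →
      (configBC1 r s).FieldIsIdentity (configBC1 r 0).mult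
        (-1 / (2 * (r + 8 * s))) (-(r * (r + 4 * s)) / (r + 8 * s))) := by

  refine ⟨fun q r hr h0 => ⟨(F4.fieldIsIdentity h0).1 hr, (F4.fieldIsIdentity_A1one h0).1 hr,
      (F4.fieldIsIdentity_A1two h0).1 hr, (F4.fieldIsIdentity_A2one h0).1 hr,
      (F4.fieldIsIdentity_A2two h0).1 hr, (F4.fieldIsIdentity_B2 h0).1 hr,
      (F4.fieldIsIdentity_A1sq h0).1 hr⟩,
    fun q r hr h0 => ⟨(F4.fieldIsIdentity h0).2 hr, (F4.fieldIsIdentity_A1one h0).2 hr,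
      (F4.fieldIsIdentity_A1two h0).2 hr, (F4.fieldIsIdentity_A2one h0).2 hr,
      (F4.fieldIsIdentity_A2two h0).2 hr, (F4.fieldIsIdentity_B2 h0).2 hr,
      (F4.fieldIsIdentity_A1sq h0).2 hr⟩,
    fun q p hp h0 => (G2.fieldIsIdentity h0).1 hp, fun q p hp h0 => (G2.fieldIsIdentity h0).2 hp,
    fun n q r s m w hn hq hr hm hw h => BC.fieldIsIdentity hn hq hr hm hw h,
    fun r s hr hrs => BC1.fieldIsIdentity hr hrs⟩
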